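/- \textbf{Setting.} Bit strings of length $t$ are elements of $\mathbf F_2^t$; $|c|$ is the number of $1$-bits of $c$ and $d_H$ the Hamming distance. Let $|0^0\rangle,|1^0\rangle$ be the computational ($z$) basis of the qubit space and $|0^1\rangle=\frac{|0^0\rangle+|1^0\rangle}{\sqrt2}$, $|1^1\rangle=\frac{|0^0\rangle-|1^0\rangle}{\sqrt2}$ the $x$ basis. Let $n,n_z,n_x,m\ge 1$ and $r\ge 0$ be integers, $N=n+n_z+n_x$, and let $p_{a,z},p_{a,x}$ be real numbers. Let $P_C$ be an $r\times n$ matrix and $P_K$ an $m\times n$ matrix over $\mathbf F_2$ such that the $r+m$ rows $v_1,\dots,v_r$ (of $P_C$), $v_{r+1},\dots,v_{r+m}$ (of $P_K$) are linearly independent. With $V_{r'}=\operatorname{Span}\{v_1,\dots,v_{r'}\}$ put $$d_{r,m}=\min_{r\le r'<r+m} d_H(v_{r'+1},V_{r'}).$$ \textbf{Protocol (BB84-INFO-$z$).} Alice chooses uniformly at random a partition $\mathcal P=(\mathbf s,\mathbf z,\mathbf b)$, i.e. three strings in $\mathbf F_2^N$ with $|\mathbf s|=n$, $|\mathbf z|=n_z$,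 $|\mathbf b|=n_x$, $|\mathbf s+\mathbf z+\mathbf b|=N$ (the positions of their $1$-bits are the INFO, TEST-Z and TEST-X bits), and, independently and uniformly, a string $\mathbf i\in\mathbf F_2^N$. She sends the qubits $|i_1^{b_1}\rangle,\dots,|i_N^{b_N}\rangle$; Bob measures the $j$-th received qubit in the basis $\{|0^{b_j}\rangle,|1^{b_j}\rangle\}$ and gets $i^B_j$. Let $\mathbf c=\mathbf i+\mathbf i^B$, and let $\mathbf c_{\mathbf s},\mathbf c_{\mathbf z},\mathbf c_{\mathbf b}$ be its substrings on the INFO, TEST-Z and TEST-X bits. Alice publishes the syndrome $\xi=\mathbf xP_C^{T}$ of the INFO string $\mathbf x=\mathbf i_{\mathbf s}$; the final key is $\mathbf xP_K^{T}\in\mathbf F_2^m$. \textbf{Attack.} Eve performs a collective attack, chosen independently of $\mathbf i$ and $\mathcal P$: for each $j$ she attaches to the $j$-th qubit a probe in a normalized pure state $|0^E\rangle_{E_j}$ of a finite-dimensional space of her choice, applies a unitary $U_j$ of her choice to the probe and the qubit, keeps the probe, and sends the qubit on to Bob. Given $\mathcal P$, let $\rho_{\mathbf x}$ be the resulting state of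 her probes of the INFO bits if Alice sent the INFO string $\mathbf x$ (the tensor product of the reduced probe states), and for a syndrome $\xi\in\mathbf F_2^r$ and a key $\mathbf k\in\mathbf F_2^m$ let $$\widehat\rho_{\mathbf k}=\frac1{2^{n-r-m}}\sum_{\mathbf x:\ \mathbf xP_C^{T}=\xi,\ \mathbf xP_K^{T}=\mathbf k}\rho_{\mathbf x}.$$ For two keys $\mathbf k,\mathbf k'$ define $\Delta_{\rm Eve}(\mathbf k,\mathbf k'\mid\mathcal P,\xi,\mathbf c_{\mathbf z},\mathbf c_{\mathbf b})=\frac12\operatorname{tr}|\widehat\rho_{\mathbf k}-\widehat\rho_{\mathbf k'}|$ if $\frac{|\mathbf c_{\mathbf z}|}{n_z}\le p_{a,z}$ and $\frac{|\mathbf c_{\mathbf b}|}{n_x}\le p_{a,x}$, and $\Delta_{\rm Eve}=0$ otherwise, and let $$\langle\Delta_{\rm Eve}(\mathbf k,\mathbf k')\rangle=\sum_{\mathcal P,\xi,\mathbf c_{\mathbf z},\mathbf c_{\mathbf b}}\Delta_{\rm Eve}(\mathbf k,\mathbf k'\mid\mathcal P,\xi,\mathbf c_{\mathbf z},\mathbf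 c_{\mathbf b})\;p(\mathcal P,\xi,\mathbf c_{\mathbf z},\mathbf c_{\mathbf b}),$$ where $p(\mathcal P,\xi,\mathbf c_{\mathbf z},\mathbf c_{\mathbf b})$ is the joint probability in the protocol. \textbf{Theorem.} For every collective attack and any two keys $\mathbf k,\mathbf k'\in\mathbf F_2^m$, $$\langle\Delta_{\rm Eve}(\mathbf k,\mathbf k')\rangle\le 2m\sqrt{P\left[\left(\frac{|\widetilde{\mathbf C}_I|}{n}\ge\frac{d_{r,m}}{2n}\right)\wedge\left(\frac{|\mathbf C_{T_Z}|}{n_z}\le p_{a,z}\right)\wedge\left(\frac{|\mathbf C_{T_X}|}{n_x}\le p_{a,x}\right)\right]}.$$ Here the probability refers to the virtual run with the same attack in which the INFO bits are encoded by Alice and measured by Bob in the $x$ basis, all else being unchanged, and $\widetilde{\mathbf C}_I,\mathbf C_{T_Z},\mathbf C_{T_X}$ are the strings of errors on the INFO, TEST-Z and TEST-X bits in that run. -/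

import Mathlib

open scoped BigOperators

namespace BB84InfoZ

noncomputable section

/-! ## Bit strings and codes -/

/-- Bit strings of length `t`, as vectors over the field with two elements.
The number of `1`-bits of `c` is `hammingNorm c`, the Hamming distance is `hammingDist`. -/
abbrev BitString (t : ℕ) : Type := Fin t → ZMod 2

/-- The positions of the `1`-bits of a string `s` of weight `k`, in increasing order. -/
def positions {N k : ℕ} (s : BitString N) (hs : hammingNorm s = k) : Fin k ↪o Fin N :=
  (Finset.univ.filter fun j => s j ≠ 0).orderEmbOfFin hs

/-- The substring `c_s` of `c` that consists of the bits `c_j` with `s_j = 1`. -/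
def substring {N k : ℕ} (s : BitString N) (hs : hammingNorm s = k) (c : BitString N) :
    BitString k :=
  fun l => c (positions s hs l)

/-- The error rate `|c| / t` of a string of errors `c` of length `t`. -/
def errorRate {t : ℕ} (c : BitString t) : ℝ := (hammingNorm c : ℝ) / (t : ℝ)

/-- The Hamming distance `d_H(w, V)` of a vector from a subspace. -/
def distToSubspace {n : ℕ} (w : BitString n) (V : Submodule (ZMod 2) (BitString n)) : ℕ :=
  sInf {d : ℕ | ∃ u ∈ V, hammingDist w u = d}

/-- The vectors `v_1, …, v_{r+m}` (indexed from `0`): the rows of the parity check matrix `PC`,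
followed by the rows of the privacy amplification matrix `PK`. -/
def codeRows {n r m : ℕ} (PC : Matrix (Fin r) (Fin n) (ZMod 2))
    (PK : Matrix (Fin m) (Fin n) (ZMod 2)) : Fin (r + m) → BitString n :=
  Fin.append PC.row PK.row

/-- `d_{r,m} = min_{r ≤ r' < r+m} d_H(v_{r'+1}, V_{r'})`, with `V_{r'} = Span {v_1, …, v_{r'}}`.
As rows are indexed from `0`, the vector `v_{r'+1}` is the row of index `r'`. -/
def minDist {n r m : ℕ} (PC : Matrix (Fin r) (Fin n) (ZMod 2))
    (PK : Matrix (Fin m) (Fin n) (ZMod 2)) : ℕ :=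
  sInf {d : ℕ | ∃ r' : Fin (r + m), r ≤ (r' : ℕ) ∧
    d = distToSubspace (codeRows PC PK r')
      (Submodule.span (ZMod 2) (codeRows PC PK '' {i | i < r'}))}

/-! ## Partitions into INFO, TEST-Z and TEST-X bits -/

/-- A partition `(s, z, b)` of the `N = n + nz + nx` bits into `n` INFO bits (`s_j = 1`),
`nz` TEST-Z bits (`z_j = 1`) and `nx` TEST-X bits (`b_j = 1`). -/
@[ext]
structure BitPartition (n nz nx : ℕ) where
  s : BitString (n + nz + nx)
  z : BitString (n + nz + nx)
  b : BitString (n + nz + nx)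
  weight_s : hammingNorm s = n
  weight_z : hammingNorm z = nz
  weight_b : hammingNorm b = nx
  weight_add : hammingNorm (s + z + b) = n + nz + nx

instance (n nz nx : ℕ) : Fintype (BitPartition n nz nx) :=
  Fintype.ofInjective
    (fun P : BitPartition n nz nx => (P.s, P.z, P.b))
    (fun P Q h => by
      simp only [Prod.mk.injEq] at h
      exact BitPartition.ext h.1 h.2.1 h.2.2)

namespace BitPartition

variable {n nz nx : ℕ} (P : BitPartition n nz nx)

/-- The substring of the INFO bits. -/
def info (c : BitString (n + nz + nx)) : BitString n := substring P.s P.weight_s c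

/-- The substring of the TEST-Z bits. -/
def testZ (c : BitString (n + nz + nx)) : BitString nz := substring P.z P.weight_z c

/-- The substring of the TEST-X bits. -/
def testX (c : BitString (n + nz + nx)) : BitString nx := substring P.b P.weight_b c

/-- The position, among all the bits, of the `l`-th INFO bit. -/
def infoPos (l : Fin n) : Fin (n + nz + nx) := positions P.s P.weight_s l

/-- The bases in which the qubits are encoded and measured in the protocol: the `x` basis (`1`)
for the TEST-X bits, the `z` basis (`0`) for all the other bits. -/
def realBases : BitString (n + nz + nx) := P.b

/-- The bases in the virtual run in which the INFO bits, too, are encoded and measured in the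
`x` basis. -/
def virtualBases : BitString (n + nz + nx) := P.b + P.s

end BitPartition

/-! ## Qubits and collective attacks -/

/-- The qubit state `|a^β⟩`: for `β = 0` the computational (`z`) basis, for `β = 1` the `x` basis
`|0^1⟩ = (|0⟩ + |1⟩)/√2`, `|1^1⟩ = (|0⟩ - |1⟩)/√2`. -/
def ket (β a : ZMod 2) : ZMod 2 → ℂ := fun t =>
  if β = 0 then (if t = a then 1 else 0)
  else (if t = 1 ∧ a = 1 then -1 else 1) / (Real.sqrt 2 : ℂ)

/-- A collective attack on `N` qubits: for every `j`, a finite-dimensional probe space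
(with an orthonormal basis indexed by `Fin (dim j)`), a normalized initial probe state `|0^E⟩`,
and a unitary operator on the compound system of the `j`-th probe and the `j`-th qubit. -/
structure CollectiveAttack (N : ℕ) where
  dim : Fin N → ℕ
  init : ∀ j, Fin (dim j) → ℂ
  init_normalized : ∀ j, ∑ e, ‖init j e‖ ^ 2 = 1
  U : ∀ j, Matrix.unitaryGroup (Fin (dim j) × ZMod 2) ℂ

namespace CollectiveAttack

variable {N : ℕ} (A : CollectiveAttack N)

/-- The joint state `U_j |0^E⟩ |a^β⟩` of the `j`-th probe and the `j`-th qubit, after the attack,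
if Alice sends `|a^β⟩`. -/
def evolved (j : Fin N) (β a : ZMod 2) : Fin (A.dim j) × ZMod 2 → ℂ :=
  (A.U j : Matrix (Fin (A.dim j) × ZMod 2) (Fin (A.dim j) × ZMod 2) ℂ).mulVec
    (fun p => A.init j p.1 * ket β a p.2)

/-- The (non-normalized) state `(1 ⊗ ⟨y^β|) U_j |0^E⟩ |a^β⟩` of the `j`-th probe: the vector
`E^β_{a y}` of the expansion of `U_j |0^E⟩ |a^β⟩` in the basis `|0^β⟩, |1^β⟩` of the qubit. -/
def probeVec (j : Fin N) (β a y : ZMod 2) : Fin (A.dim j) → ℂ :=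
  fun e => ∑ t, star (ket β y t) * A.evolved j β a (e, t)

/-- The probability that Bob, measuring the `j`-th qubit in the basis `β`, gets the bit `y`,
if Alice sends `|a^β⟩` (Born rule). -/
def bobProb (j : Fin N) (β a y : ZMod 2) : ℝ := ∑ e, ‖A.probeVec j β a y e‖ ^ 2

/-- The density matrix of the `j`-th probe after the attack, if Alice sends `|a^β⟩`: the partial
trace of the joint state over the qubit. -/
def probeState (j : Fin N) (β a : ZMod 2) : Matrix (Fin (A.dim j)) (Fin (A.dim j)) ℂ :=
  fun e e' => ∑ t, A.evolved j β a (e, t) * star (A.evolved j β a (e', t))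

end CollectiveAttack

/-! ## Eve's states -/

open scoped MatrixOrder in
/-- The trace distance `(1/2) tr |ρ - σ|`, where `|X| = √(Xᴴ X)`. -/
def traceDist {ι : Type*} [Fintype ι] [DecidableEq ι] (ρ σ : Matrix ι ι ℂ) : ℝ :=
  (1 / 2) * (Matrix.trace (CFC.abs (ρ - σ))).re

section Eve

variable {n nz nx r m : ℕ}

/-- The index set of an orthonormal basis of the tensor product of the probe spaces attached to the
INFO qubits. -/
abbrev EveIndex (A : CollectiveAttack (n + nz + nx)) (P : BitPartition n nz nx) : Type :=
  ∀ l : Fin n, Fin (A.dim (P.infoPos l))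

/-- Eve's state `ρ_x^{b'}`, the tensor product of her probe states on the INFO bits, given that
Alice sent the INFO bit string `x` encoded in the bases `b' = b_s` of the protocol. -/
def eveState (A : CollectiveAttack (n + nz + nx)) (P : BitPartition n nz nx) (x : BitString n) :
    Matrix (EveIndex A P) (EveIndex A P) ℂ :=
  fun f g => ∏ l, A.probeState (P.infoPos l) (P.info P.realBases l) (x l) (f l) (g l)

/-- Eve's state corresponding to the final key `k`, given that she knows the syndrome `ξ`:
the average of `ρ_x^{b'}` over the `2^(n-r-m)` strings `x` with syndrome `ξ` and key `k`. -/
def eveKeyState (A : CollectiveAttack (n + nz + nx)) (P : BitPartition n nz nx)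
    (PC : Matrix (Fin r) (Fin n) (ZMod 2)) (PK : Matrix (Fin m) (Fin n) (ZMod 2))
    (ξ : BitString r) (k : BitString m) : Matrix (EveIndex A P) (EveIndex A P) ℂ :=
  ((2 : ℂ) ^ (n - r - m))⁻¹ •
    ∑ x ∈ Finset.univ.filter (fun x : BitString n => PC.mulVec x = ξ ∧ PK.mulVec x = k),
      eveState A P x

/-- The random variable `Δ_Eve(k, k' | P, ξ, c_z, c_b)`: the trace distance between Eve's states for
the keys `k` and `k'` if the test is passed, and `0` if it fails. -/
def deltaEve (A : CollectiveAttack (n + nz + nx))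
    (PC : Matrix (Fin r) (Fin n) (ZMod 2)) (PK : Matrix (Fin m) (Fin n) (ZMod 2))
    (paz pax : ℝ) (k k' : BitString m)
    (P : BitPartition n nz nx) (ξ : BitString r) (cz : BitString nz) (cb : BitString nx) : ℝ :=
  open Classical in
  if errorRate cz ≤ paz ∧ errorRate cb ≤ pax then
    traceDist (eveKeyState A P PC PK ξ k) (eveKeyState A P PC PK ξ k')
  else 0

/-! ## Probabilities -/

/-- The probability of the elementary event that the partition `P` is chosen, Alice sends the
bits `i` and Bob measures the bits `iB`, if the qubits are encoded and measured in the bases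
`bases P`. The partition and the string `i` are independent and uniformly distributed, and
the qubits are attacked one by one. -/
def outcomeProb (A : CollectiveAttack (n + nz + nx))
    (bases : BitPartition n nz nx → BitString (n + nz + nx))
    (P : BitPartition n nz nx) (i iB : BitString (n + nz + nx)) : ℝ :=
  (Fintype.card (BitPartition n nz nx) : ℝ)⁻¹ * ((2 : ℝ) ^ (n + nz + nx))⁻¹ *
    ∏ j, A.bobProb j (bases P j) (i j) (iB j)

/-- The probability of an event that concerns the partition, Alice's bits and Bob's bits. -/
def eventProb (A : CollectiveAttack (n + nz + nx))
    (bases : BitPartition n nz nx → BitString (n + nz + nx))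
    (E : BitPartition n nz nx → BitString (n + nz + nx) → BitString (n + nz + nx) → Prop) : ℝ :=
  open Classical in
  ∑ P, ∑ i, ∑ iB, if E P i iB then outcomeProb A bases P i iB else 0

/-- The expected value `⟨Δ_Eve(k, k')⟩`: the sum of `Δ_Eve(k, k' | P, ξ, c_z, c_b)` times
`p(P, ξ, c_z, c_b)` over the partitions `P`, the syndromes `ξ` of the INFO string `x = i_s`, and
the error strings `c_z`, `c_b` (with `c = i + iB`) on the TEST-Z and TEST-X bits. -/
def expectedDeltaEve (A : CollectiveAttack (n + nz + nx))
    (PC : Matrix (Fin r) (Fin n) (ZMod 2)) (PK : Matrix (Fin m) (Fin n) (ZMod 2))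
    (paz pax : ℝ) (k k' : BitString m) : ℝ :=
  ∑ P : BitPartition n nz nx, ∑ ξ : BitString r, ∑ cz : BitString nz, ∑ cb : BitString nx,
    deltaEve A PC PK paz pax k k' P ξ cz cb *
      eventProb A BitPartition.realBases (fun Q i iB =>
        Q = P ∧ PC.mulVec (Q.info i) = ξ ∧ Q.testZ (i + iB) = cz ∧ Q.testX (i + iB) = cb)

end Eve

end

end BB84InfoZ

/-!
Write `|c|` for the weight of a string `c`. Eve's state `ρ_x` of the INFO probes has a purification
that is the Walsh transform, at `x`, of pairwise orthogonal vectors `H d`, where `‖H d‖²` is the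
probability of the string of errors `d` when the INFO bits are encoded and measured in the `x`
basis: this is the uncertainty relation between the two bases. As the attack is collective, it
suffices to see this for one qubit.

Now reveal the key bit by bit. If the parities of `x` with the rows of `R` are known, the average of
`(-1)^(x·v) ρ_x` over the remaining `x` becomes, by Parseval's identity, a sum of products of
components of `H` on pairs of cosets of the row space that differ by `v`. If `v` is at distance at
least `D` from the row space, one coset of each pair consists of strings with `2 |d| ≥ D`, so by the
Cauchy–Schwarz inequality learning the parity with `v` changes Eve's state by at most
`2 √P[2 |d| ≥ D]` in trace norm. Going from the syndrome alone to either of the two keys takes `m`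
such steps, which gives `2m √P[2 |d| ≥ D]` for the trace distance.

Given the partition, the errors on the INFO bits are independent of those on the test bits, and the
latter have the same distribution in the virtual run. The concavity of the square root then moves
the average over the partitions inside.
-/

namespace BB84InfoZ

noncomputable section

open scoped Matrix

/-! ## Signs and Walsh transforms -/

/-- The nontrivial character `a ↦ (-1)^a` of the field with two elements. -/
def bitSign : AddChar (ZMod 2) ℂ := AddChar.zmodChar 2 (ζ := -1) (by norm_num)

@[simp] lemma bitSign_one : bitSign 1 = -1 := by
  simp [bitSign, AddChar.zmodChar_apply, ZMod.val_one]

lemma zmod_two_eq_zero_or_one (a : ZMod 2) : a = 0 ∨ a = 1 := by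
  decide +revert

lemma sum_zmod_two {M : Type*} [AddCommMonoid M] (f : ZMod 2 → M) : ∑ a, f a = f 0 + f 1 :=
  Fin.sum_univ_two f

@[simp] lemma bitSign_mul_self (a : ZMod 2) : bitSign a * bitSign a = 1 := by
  rw [← AddChar.map_add_eq_mul, ZModModule.add_self, AddChar.map_zero_eq_one]

@[simp] lemma star_bitSign (a : ZMod 2) : star (bitSign a) = bitSign a := by
  rcases zmod_two_eq_zero_or_one a with rfl | rfl <;> simp

@[simp] lemma norm_bitSign (a : ZMod 2) : ‖bitSign a‖ = 1 :=
  bitSign.norm_apply a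

lemma bitSign_mul_bitSign (a b : ZMod 2) :
    bitSign a * bitSign b = 2 * (if a = b then 1 else 0) - 1 := by
  rcases zmod_two_eq_zero_or_one a with rfl | rfl <;>
    rcases zmod_two_eq_zero_or_one b with rfl | rfl <;> norm_num

section Walsh

variable {ι κ : Type*} [Fintype ι] [Fintype κ]

lemma sum_bitSign_mul (a : ZMod 2) : ∑ b, bitSign (b * a) = if a = 0 then 2 else 0 := by
  rcases zmod_two_eq_zero_or_one a with rfl | rfl <;> norm_num [sum_zmod_two]

lemma bitSign_dotProduct (x d : ι → ZMod 2) :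
    bitSign (x ⬝ᵥ d) = ∏ i, bitSign (x i * d i) :=
  map_prod bitSign.toMonoidHom (fun i => Multiplicative.ofAdd (x i * d i)) Finset.univ

lemma sum_bitSign_dotProduct [DecidableEq ι] (d : ι → ZMod 2) :
    ∑ x : ι → ZMod 2, bitSign (x ⬝ᵥ d) = if d = 0 then 2 ^ Fintype.card ι else 0 := by
  simp only [bitSign_dotProduct, ← Fintype.prod_sum (fun i b => bitSign (b * d i)),
    sum_bitSign_mul, Finset.prod_ite_zero, Finset.prod_const, Finset.card_univ, funext_iff,
    Finset.mem_univ, true_imp_iff, Pi.zero_apply]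

/-- The Walsh transform (Fourier transform over `(ZMod 2)^ι`, not normalized) of a vector-valued
function. -/
def walshTransform [DecidableEq ι] {M : Type*} [AddCommMonoid M] [Module ℂ M]
    (H : (ι → ZMod 2) → M) (x : ι → ZMod 2) : M :=
  ∑ d, bitSign (x ⬝ᵥ d) • H d

/-- The sum of `H` over the translate by `d` of the space spanned by the rows of `R`, twisted by
the character of that space given by `w`. Its Walsh transform is supported where `R *ᵥ x = w`. -/
def twistedCosetSum [DecidableEq κ] {M : Type*} [AddCommMonoid M] [Module ℂ M]
    (H : (ι → ZMod 2) → M) (R : Matrix κ ι (ZMod 2)) (w : κ → ZMod 2) (d : ι → ZMod 2) : M :=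
  ∑ t : κ → ZMod 2, bitSign (t ⬝ᵥ w) • H (d + t ᵥ* R)

variable [DecidableEq ι]

lemma walshTransform_comp_add_right {M : Type*} [AddCommMonoid M] [Module ℂ M]
    (H : (ι → ZMod 2) → M) (c x : ι → ZMod 2) :
    walshTransform (fun d => H (d + c)) x = bitSign (x ⬝ᵥ c) • walshTransform H x := by
  rw [walshTransform, walshTransform, Finset.smul_sum, ← Equiv.sum_comp (Equiv.addRight c)]
  refine Finset.sum_congr rfl fun d _ => ?_
  rw [Equiv.coe_addRight, add_assoc, ZModModule.add_self, add_zero, smul_smul, dotProduct_add,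
    AddChar.map_add_eq_mul, mul_comm]

lemma walshTransform_twistedCosetSum [DecidableEq κ] {M : Type*} [AddCommMonoid M] [Module ℂ M]
    (H : (ι → ZMod 2) → M) (R : Matrix κ ι (ZMod 2)) (w : κ → ZMod 2) (x : ι → ZMod 2) :
    walshTransform (twistedCosetSum H R w) x =
      if R *ᵥ x = w then (2 : ℂ) ^ Fintype.card κ • walshTransform H x else 0 := by
  have hiff : R *ᵥ x + w = 0 ↔ R *ᵥ x = w := by rw [← ZModModule.sub_eq_add, sub_eq_zero]
  calc walshTransform (twistedCosetSum H R w) x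
      = ∑ t : κ → ZMod 2, bitSign (t ⬝ᵥ w) • walshTransform (fun d => H (d + t ᵥ* R)) x := by
        simp only [walshTransform, twistedCosetSum, Finset.smul_sum]
        rw [Finset.sum_comm]
        simp only [smul_comm (bitSign (_ ⬝ᵥ w))]
    _ = ∑ t : κ → ZMod 2, bitSign (t ⬝ᵥ (R *ᵥ x + w)) • walshTransform H x := by
        refine Finset.sum_congr rfl fun t _ => ?_
        rw [walshTransform_comp_add_right, smul_smul, dotProduct_comm x, ← Matrix.dotProduct_mulVec,
          dotProduct_add, AddChar.map_add_eq_mul, mul_comm]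
    _ = _ := by
        rw [← Finset.sum_smul, sum_bitSign_dotProduct, ite_smul, zero_smul]
        simp only [hiff]

lemma sum_bitSign_smul_walshTransform_mul_conjTranspose {α β : Type*} [Fintype β]
    (H : (ι → ZMod 2) → Matrix α β ℂ) (v : ι → ZMod 2) :
    ∑ x, bitSign (x ⬝ᵥ v) • (walshTransform H x * (walshTransform H x)ᴴ) =
      (2 : ℂ) ^ Fintype.card ι • ∑ d, H d * (H (d + v))ᴴ := by
  have expand (x : ι → ZMod 2) :
      bitSign (x ⬝ᵥ v) • (walshTransform H x * (walshTransform H x)ᴴ) =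
        ∑ d, ∑ d', bitSign (x ⬝ᵥ (d + v + d')) • (H d * (H d')ᴴ) := by
    simp only [walshTransform, Matrix.conjTranspose_sum, Matrix.conjTranspose_smul, star_bitSign,
      Matrix.sum_mul, Matrix.mul_sum, Matrix.smul_mul, Matrix.mul_smul, smul_smul,
      Finset.smul_sum, dotProduct_add, AddChar.map_add_eq_mul]
    rw [Finset.sum_comm]
    refine Finset.sum_congr rfl fun d _ => Finset.sum_congr rfl fun d' _ => ?_
    congr 1
    ring
  have hiff (d d' : ι → ZMod 2) : d + v + d' = 0 ↔ d + v = d' := by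
    rw [← ZModModule.sub_eq_add, sub_eq_zero]
  simp only [expand]
  rw [Finset.sum_comm, Finset.smul_sum]
  refine Finset.sum_congr rfl fun d _ => ?_
  rw [Finset.sum_comm]
  simp only [← Finset.sum_smul, sum_bitSign_dotProduct, hiff, ite_smul, zero_smul,
    Finset.sum_ite_eq, Finset.mem_univ, if_true]

end Walsh

/-! ## The Hilbert–Schmidt norm and the trace distance -/

section Trace

variable {α β τ : Type*} [Fintype α] [Fintype β]

open scoped MatrixOrder in
lemma exists_unitary_mul_eq_abs [DecidableEq α] {X : Matrix α α ℂ} (hX : X.IsHermitian) :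
    ∃ S ∈ Matrix.unitaryGroup α ℂ, S * X = CFC.abs X := by
  have hX' : IsSelfAdjoint X := hX
  have hcont (f : ℝ → ℝ) : ContinuousOn f (spectrum ℝ X) :=
    Matrix.finite_real_spectrum.continuousOn f
  let sgn : ℝ → ℝ := fun t => if 0 ≤ t then 1 else -1
  refine ⟨cfc sgn X, (cfc_unitary_iff sgn X hX' (hcont _)).mpr fun t _ => ?_, ?_⟩
  · simp only [sgn]
    split_ifs <;> norm_num
  · rw [CFC.abs_eq_cfc_norm X hX']
    nth_rewrite 2 [← cfc_id' ℝ X]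
    rw [← cfc_mul sgn _ X (hcont _) (hcont _)]
    congr 1 with t
    simp only [sgn]
    split_ifs with ht
    · rw [one_mul, Real.norm_of_nonneg ht]
    · rw [neg_one_mul, Real.norm_of_nonpos (not_le.mp ht).le]

lemma traceDist_le_of_forall_unitary [DecidableEq α] {ρ σ : Matrix α α ℂ} (hρ : ρ.IsHermitian)
    (hσ : σ.IsHermitian) {K : ℝ}
    (h : ∀ S ∈ Matrix.unitaryGroup α ℂ, dist (S * ρ).trace (S * σ).trace ≤ 2 * K) :
    traceDist ρ σ ≤ K := by
  obtain ⟨S, hS, hSX⟩ := exists_unitary_mul_eq_abs (hρ.sub hσ)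
  have hre := (Complex.re_le_norm (S * (ρ - σ)).trace).trans_eq
    (by rw [Matrix.mul_sub, Matrix.trace_sub, ← dist_eq_norm])
  rw [hSX] at hre
  rw [traceDist]
  linarith [h S hS]

open scoped Matrix.Norms.Frobenius

lemma frobenius_norm_sq (A : Matrix α β ℂ) : ‖A‖ ^ 2 = ∑ i, ∑ j, ‖A i j‖ ^ 2 := by
  rw [Matrix.frobenius_norm_def, ← Real.sqrt_eq_rpow, Real.sq_sqrt (by positivity)]
  simp only [Real.rpow_two]

lemma trace_mul_conjTranspose_self (A : Matrix α β ℂ) :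
    (A * Aᴴ).trace = ((‖A‖ ^ 2 : ℝ) : ℂ) := by
  simp only [Matrix.trace, Matrix.diag, Matrix.mul_apply, Matrix.conjTranspose_apply,
    frobenius_norm_sq, Complex.ofReal_sum, RCLike.star_def, Complex.mul_conj,
    Complex.normSq_eq_norm_sq]

lemma norm_trace_mul_conjTranspose_le (A B : Matrix α β ℂ) : ‖(A * Bᴴ).trace‖ ≤ ‖A‖ * ‖B‖ := by
  have hsqrt (C : Matrix α β ℂ) : ‖C‖ = √(∑ p : α × β, ‖C p.1 p.2‖ ^ 2) := by
    rw [Fintype.sum_prod_type, ← Real.sqrt_sq (norm_nonneg C), frobenius_norm_sq]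
  calc ‖(A * Bᴴ).trace‖ = ‖∑ p : α × β, A p.1 p.2 * star (B p.1 p.2)‖ := by
        rw [Fintype.sum_prod_type]
        rfl
    _ ≤ ∑ p : α × β, ‖A p.1 p.2‖ * ‖B p.1 p.2‖ := by
        refine (norm_sum_le _ _).trans_eq ?_
        simp only [norm_mul, norm_star]
    _ ≤ _ := by
        rw [hsqrt A, hsqrt B]
        exact Real.sum_mul_le_sqrt_mul_sqrt _ _ _

lemma frobenius_norm_unitary_mul [DecidableEq α] {S : Matrix α α ℂ}
    (hS : S ∈ Matrix.unitaryGroup α ℂ) (A : Matrix α β ℂ) : ‖S * A‖ = ‖A‖ := by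
  have hsq : ((‖S * A‖ ^ 2 : ℝ) : ℂ) = (‖A‖ ^ 2 : ℝ) := by
    rw [← trace_mul_conjTranspose_self, ← trace_mul_conjTranspose_self,
      Matrix.conjTranspose_mul, Matrix.trace_mul_comm, Matrix.mul_assoc, ← Matrix.mul_assoc _ S A,
      ← Matrix.star_eq_conjTranspose S, Matrix.mem_unitaryGroup_iff'.mp hS, Matrix.one_mul,
      Matrix.trace_mul_comm]
  exact (sq_eq_sq₀ (norm_nonneg _) (norm_nonneg _)).mp (Complex.ofReal_injective hsq)

lemma norm_trace_unitary_mul_le [DecidableEq α] {S : Matrix α α ℂ}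
    (hS : S ∈ Matrix.unitaryGroup α ℂ) (A B : Matrix α β ℂ) :
    ‖(S * (A * Bᴴ)).trace‖ ≤ ‖A‖ * ‖B‖ := by
  rw [← Matrix.mul_assoc, ← frobenius_norm_unitary_mul hS A]
  exact norm_trace_mul_conjTranspose_le _ _

lemma frobenius_norm_sq_sum_smul [Fintype τ] {c : τ → ℂ} (hc : ∀ t, ‖c t‖ = 1)
    {A : τ → Matrix α β ℂ} (hA : Pairwise fun t t' => (A t * (A t')ᴴ).trace = 0) :
    ‖∑ t, c t • A t‖ ^ 2 = ∑ t, ‖A t‖ ^ 2 := by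
  have key : ((‖∑ t, c t • A t‖ ^ 2 : ℝ) : ℂ) = ((∑ t, ‖A t‖ ^ 2 : ℝ) : ℂ) := by
    simp only [← trace_mul_conjTranspose_self, Matrix.conjTranspose_sum, Matrix.sum_mul,
      Matrix.mul_sum, Matrix.trace_sum, Complex.ofReal_sum, Matrix.conjTranspose_smul,
      Matrix.smul_mul, Matrix.mul_smul, Matrix.trace_smul, smul_eq_mul]
    refine Finset.sum_congr rfl fun t _ => ?_
    rw [Finset.sum_eq_single t (fun t' _ ht => by rw [hA ht, mul_zero]) (by simp),
      ← mul_assoc, RCLike.star_def, Complex.conj_mul', hc, Complex.ofReal_one, one_pow, one_mul]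
  exact Complex.ofReal_injective key

end Trace

/-! ## One key bit -/

section KeyBit

open scoped Matrix.Norms.Frobenius

lemma sum_mul_add_right_le {G : Type*} [AddGroup G] [Fintype G] {y : G → ℝ} (hy : ∀ d, 0 ≤ y d)
    (v : G) (p : G → Prop) [DecidablePred p] (hp : ∀ d, p d ∨ p (d + v)) :
    ∑ d, y d * y (d + v) ≤ 2 * (√(∑ d with p d, y d ^ 2) * √(∑ d, y d ^ 2)) := by
  have cauchySchwarz (s : Finset G) (f g : G → ℝ) :
      ∑ d ∈ s, f d * g d ≤ √(∑ d ∈ s, f d ^ 2) * √(∑ d, g d ^ 2) :=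
    (Real.sum_mul_le_sqrt_mul_sqrt s f g).trans <| by
      gcongr
      exact s.subset_univ
  have shift_tail : ∑ d with p (d + v), y (d + v) ^ 2 = ∑ d with p d, y d ^ 2 := by
    simp only [Finset.sum_filter]
    exact Equiv.sum_comp (Equiv.addRight v) fun d => if p d then y d ^ 2 else 0
  have shift_total : ∑ d, y (d + v) ^ 2 = ∑ d, y d ^ 2 :=
    Equiv.sum_comp (Equiv.addRight v) fun d => y d ^ 2
  calc ∑ d, y d * y (d + v)
      ≤ ∑ d with p d, y d * y (d + v) + ∑ d with p (d + v), y (d + v) * y d := by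
        simp only [Finset.sum_filter, ← Finset.sum_add_distrib]
        refine Finset.sum_le_sum fun d _ => ?_
        have h0 := mul_nonneg (hy d) (hy (d + v))
        rw [mul_comm (y (d + v))]
        rcases hp d with h | h <;> rw [if_pos h]
        exacts [le_add_of_nonneg_right (by positivity), le_add_of_nonneg_left (by positivity)]
    _ ≤ _ := by
        rw [two_mul]
        nth_rewrite 1 [← shift_total]
        rw [← shift_tail]
        exact add_le_add ((cauchySchwarz _ _ _).trans_eq (by rw [shift_tail])) (cauchySchwarz _ _ _)

variable {ι κ α β : Type*} [Fintype κ]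

lemma frobenius_norm_sq_twistedCosetSum [DecidableEq κ] [Fintype α] [Fintype β]
    {H : (ι → ZMod 2) → Matrix α β ℂ}
    (horth : Pairwise fun d d' => (H d * (H d')ᴴ).trace = 0) {R : Matrix κ ι (ZMod 2)}
    (hR : LinearIndependent (ZMod 2) R.row) (w : κ → ZMod 2) (d : ι → ZMod 2) :
    ‖twistedCosetSum H R w d‖ ^ 2 = ∑ t, ‖H (d + t ᵥ* R)‖ ^ 2 :=
  frobenius_norm_sq_sum_smul (fun _ => norm_bitSign _) fun _ _ ht =>
    horth fun h => ht (Matrix.vecMul_injective_iff.mpr hR (add_left_cancel h))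

variable [Fintype ι]

lemma sum_sum_add_vecMul [DecidableEq ι] [DecidableEq κ] (R : Matrix κ ι (ZMod 2))
    (g : (ι → ZMod 2) → ℝ) :
    ∑ d, ∑ t : κ → ZMod 2, g (d + t ᵥ* R) = 2 ^ Fintype.card κ * ∑ d, g d := by
  rw [Finset.sum_comm]
  have shift (t : κ → ZMod 2) : ∑ d, g (d + t ᵥ* R) = ∑ d, g d :=
    Equiv.sum_comp (Equiv.addRight (t ᵥ* R)) g
  simp [shift]

/-- Vectors of weight below `D / 2` in both cosets would differ by one of weight below `D`. -/
lemma forall_le_two_mul_hammingNorm_or {R : Matrix κ ι (ZMod 2)} {v : ι → ZMod 2} {D : ℕ}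
    (hD : ∀ t, D ≤ hammingDist v (t ᵥ* R)) (d : ι → ZMod 2) :
    (∀ t, D ≤ 2 * hammingNorm (d + t ᵥ* R)) ∨ ∀ t, D ≤ 2 * hammingNorm (d + v + t ᵥ* R) := by
  by_contra! ⟨⟨t, ht⟩, t', ht'⟩
  have hsum : -v + (t + t') ᵥ* R = -(d + t ᵥ* R) + (d + v + t' ᵥ* R) := by
    rw [Matrix.add_vecMul, neg_add, ZModModule.neg_eq_self v, ZModModule.neg_eq_self (t ᵥ* R)]
    abel
  have htri := hammingDist_triangle (d + t ᵥ* R) 0 (d + v + t' ᵥ* R)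
  rw [hammingDist_zero_right, hammingDist_zero_left, hammingDist_eq_hammingNorm, ← hsum,
    ← hammingDist_eq_hammingNorm] at htri
  have := hD (t + t')
  omega

/-- The total weight of the error strings with at least `D / 2` errors. -/
def tailWeight [DecidableEq ι] (q : (ι → ZMod 2) → ℝ) (D : ℕ) : ℝ :=
  ∑ d with D ≤ 2 * hammingNorm d, q d

lemma tailWeight_nonneg [DecidableEq ι] {q : (ι → ZMod 2) → ℝ} (hq : ∀ d, 0 ≤ q d) (D : ℕ) :
    0 ≤ tailWeight q D :=
  Finset.sum_nonneg fun d _ => hq d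

variable [Fintype β] [DecidableEq ι]

lemma smul_sum_bitSign_smul_eq [DecidableEq κ] (H : (ι → ZMod 2) → Matrix α β ℂ)
    (R : Matrix κ ι (ZMod 2)) (w : κ → ZMod 2) (v : ι → ZMod 2) :
    ((2 : ℂ) ^ Fintype.card κ / 2 ^ Fintype.card ι) •
        ∑ x with R *ᵥ x = w, bitSign (x ⬝ᵥ v) • (walshTransform H x * (walshTransform H x)ᴴ) =
      ((2 : ℂ) ^ Fintype.card κ)⁻¹ •
        ∑ d, twistedCosetSum H R w d * (twistedCosetSum H R w (d + v))ᴴ := by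
  have parseval :=
    sum_bitSign_smul_walshTransform_mul_conjTranspose (twistedCosetSum H R w) v
  have factor (x : ι → ZMod 2) :
      bitSign (x ⬝ᵥ v) • (walshTransform (twistedCosetSum H R w) x *
          (walshTransform (twistedCosetSum H R w) x)ᴴ) =
        ((2 : ℂ) ^ Fintype.card κ * (2 : ℂ) ^ Fintype.card κ) • if R *ᵥ x = w then
          bitSign (x ⬝ᵥ v) • (walshTransform H x * (walshTransform H x)ᴴ) else 0 := by
    rw [walshTransform_twistedCosetSum]
    split_ifs
    · simp only [Matrix.conjTranspose_smul, Matrix.smul_mul, Matrix.mul_smul, smul_smul, star_pow,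
        star_ofNat]
      congr 1
      ring
    · simp only [Matrix.zero_mul, smul_zero]
  simp only [factor] at parseval
  rw [← Finset.smul_sum, ← Finset.sum_filter] at parseval
  rw [← inv_smul_smul₀ (pow_ne_zero (Fintype.card ι) (two_ne_zero' ℂ)) (∑ d, _ * _), ← parseval,
    smul_smul, smul_smul]
  congr 1
  field_simp

variable [Fintype α]

lemma sum_frobenius_norm_sq_twistedCosetSum_le [DecidableEq κ]
    {H : (ι → ZMod 2) → Matrix α β ℂ} (horth : Pairwise fun d d' => (H d * (H d')ᴴ).trace = 0)
    {R : Matrix κ ι (ZMod 2)}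
    (hR : LinearIndependent (ZMod 2) R.row) (w : κ → ZMod 2) (D : ℕ) :
    ∑ d with ∀ t : κ → ZMod 2, D ≤ 2 * hammingNorm (d + t ᵥ* R), ‖twistedCosetSum H R w d‖ ^ 2 ≤
      2 ^ Fintype.card κ * tailWeight (fun d => ‖H d‖ ^ 2) D := by
  rw [tailWeight, Finset.sum_filter, Finset.sum_filter, ← sum_sum_add_vecMul R]
  refine Finset.sum_le_sum fun d _ => ?_
  split_ifs with h
  · rw [frobenius_norm_sq_twistedCosetSum horth hR]
    exact Finset.sum_le_sum fun t _ => (if_pos (h t)).ge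
  · exact Finset.sum_nonneg fun t _ => by split_ifs <;> positivity

/-- A square root of the family `ρ` that is expanded over error strings: the Walsh transform of `H`
purifies `ρ`, and the components `H d` are orthogonal, with total weight `1`. For Eve's states,
`‖H d‖ ^ 2` is the probability of the errors `d` in the conjugate basis. -/
structure IsErrorExpansion (ρ : (ι → ZMod 2) → Matrix α α ℂ) (H : (ι → ZMod 2) → Matrix α β ℂ) :
    Prop where
  eq_mul_conjTranspose : ∀ x, ρ x = walshTransform H x * (walshTransform H x)ᴴ
  orthogonal : Pairwise fun d d' => (H d * (H d')ᴴ).trace = 0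
  sum_norm_sq : ∑ d, ‖H d‖ ^ 2 = 1

variable {ρ : (ι → ZMod 2) → Matrix α α ℂ} {H : (ι → ZMod 2) → Matrix α β ℂ}

/-- Revealing one more parity `x ⬝ᵥ v` of an unknown `x` costs the square root of the probability of
half as many errors as the distance of `v` from the parities already known. -/
lemma IsErrorExpansion.norm_trace_mul_smul_sum_le [DecidableEq α] (h : IsErrorExpansion ρ H)
    {R : Matrix κ ι (ZMod 2)} (hR : LinearIndependent (ZMod 2) R.row) (w : κ → ZMod 2)
    {v : ι → ZMod 2} {D : ℕ} (hD : ∀ t, D ≤ hammingDist v (t ᵥ* R))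
    {S : Matrix α α ℂ} (hS : S ∈ Matrix.unitaryGroup α ℂ) :
    ‖(S * ((2 : ℂ) ^ Fintype.card κ / 2 ^ Fintype.card ι) •
        ∑ x with R *ᵥ x = w, bitSign (x ⬝ᵥ v) • ρ x).trace‖ ≤
      2 * √(tailWeight (fun d => ‖H d‖ ^ 2) D) := by
  classical
  set Y := twistedCosetSum H R w
  set q := tailWeight (fun d => ‖H d‖ ^ 2) D
  set c : ℝ := 2 ^ Fintype.card κ
  have hc : 0 < c := by positivity
  have total : ∑ d, ‖Y d‖ ^ 2 = c := by
    simp only [Y, frobenius_norm_sq_twistedCosetSum h.orthogonal hR]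
    rw [sum_sum_add_vecMul R fun d => ‖H d‖ ^ 2, h.sum_norm_sq, mul_one]
  simp only [h.eq_mul_conjTranspose]
  rw [smul_sum_bitSign_smul_eq, Matrix.mul_smul, Matrix.trace_smul, norm_smul, norm_inv, norm_pow,
    Complex.norm_ofNat, inv_mul_le_iff₀ hc, Matrix.mul_sum, Matrix.trace_sum]
  calc ‖∑ d, (S * (Y d * (Y (d + v))ᴴ)).trace‖ ≤ ∑ d, ‖Y d‖ * ‖Y (d + v)‖ :=
        (norm_sum_le _ _).trans (Finset.sum_le_sum fun d _ => norm_trace_unitary_mul_le hS _ _)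
    _ ≤ 2 * (√(∑ d with ∀ t : κ → ZMod 2, D ≤ 2 * hammingNorm (d + t ᵥ* R), ‖Y d‖ ^ 2) *
          √(∑ d, ‖Y d‖ ^ 2)) :=
        sum_mul_add_right_le (fun _ => norm_nonneg _) v _ (forall_le_two_mul_hammingNorm_or hD)
    _ ≤ 2 * (√(c * q) * √c) := by
        rw [total]
        gcongr
        exact sum_frobenius_norm_sq_twistedCosetSum_le h.orthogonal hR w D
    _ = c * (2 * √q) := by
        rw [Real.sqrt_mul hc.le]
        linear_combination (2 * √q) * Real.mul_self_sqrt hc.le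

end KeyBit

/-! ## From one key bit to the whole key -/

section Key

open scoped Matrix.Norms.Frobenius

variable {ι κ α β : Type*} [Fintype ι] [DecidableEq ι]

/-- The state of an adversary who knows, of a uniform string `x` in the family `ρ`, that its
parities with the rows `R i`, `i ∈ s`, are `w i`. The normalization is that of an average over such
strings if these rows are linearly independent. -/
def condState (ρ : (ι → ZMod 2) → Matrix α α ℂ) (R : Matrix κ ι (ZMod 2)) (w : κ → ZMod 2)
    (s : Finset κ) : Matrix α α ℂ :=
  ((2 : ℂ) ^ s.card / 2 ^ Fintype.card ι) • ∑ x with ∀ i ∈ s, (R *ᵥ x) i = w i, ρ x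

lemma condState_congr (ρ : (ι → ZMod 2) → Matrix α α ℂ) (R : Matrix κ ι (ZMod 2))
    {w w' : κ → ZMod 2} {s : Finset κ} (h : ∀ i ∈ s, w i = w' i) :
    condState ρ R w s = condState ρ R w' s := by
  have hiff (x : ι → ZMod 2) :
      (∀ i ∈ s, (R *ᵥ x) i = w i) ↔ ∀ i ∈ s, (R *ᵥ x) i = w' i :=
    forall₂_congr fun i hi => by rw [h i hi]
  simp only [condState, hiff]

lemma condState_eq_submatrix (ρ : (ι → ZMod 2) → Matrix α α ℂ) (R : Matrix κ ι (ZMod 2))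
    (w : κ → ZMod 2) (s : Finset κ) :
    condState ρ R w s = ((2 : ℂ) ^ Fintype.card s / 2 ^ Fintype.card ι) •
      ∑ x with R.submatrix ((↑) : s → κ) id *ᵥ x = fun i : s => w i, ρ x := by
  have hiff (x : ι → ZMod 2) : (∀ i ∈ s, (R *ᵥ x) i = w i) ↔
      R.submatrix ((↑) : s → κ) id *ᵥ x = fun i : s => w i := by
    rw [funext_iff, Subtype.forall]
    rfl
  simp only [condState, hiff, Fintype.card_coe]

lemma condState_insert [DecidableEq κ] (ρ : (ι → ZMod 2) → Matrix α α ℂ) (R : Matrix κ ι (ZMod 2))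
    (w : κ → ZMod 2) {s : Finset κ} {j : κ} (hj : j ∉ s) :
    condState ρ R w (insert j s) =
      condState ρ R w s +
        bitSign (w j) • condState (fun x => bitSign (x ⬝ᵥ R.row j) • ρ x) R w s := by
  have hbit (x : ι → ZMod 2) :
      (2 : ℂ) • (if (R *ᵥ x) j = w j then ρ x else 0) =
        ρ x + bitSign (w j) • bitSign (x ⬝ᵥ R.row j) • ρ x := by
    rw [smul_smul, dotProduct_comm x, show R.row j ⬝ᵥ x = (R *ᵥ x) j from rfl, mul_comm,
      bitSign_mul_bitSign, sub_smul, one_smul, add_sub_cancel, mul_smul, ite_smul, one_smul,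
      zero_smul]
  have hfilter : ({x | ∀ i ∈ insert j s, (R *ᵥ x) i = w i} : Finset (ι → ZMod 2)) =
      ({x | ∀ i ∈ s, (R *ᵥ x) i = w i} : Finset _).filter fun x => (R *ᵥ x) j = w j := by
    ext x
    simp only [Finset.mem_filter, Finset.mem_univ, true_and, Finset.forall_mem_insert]
    exact and_comm
  simp only [condState, hfilter]
  rw [Finset.sum_filter, smul_comm (bitSign _), ← smul_add, Finset.smul_sum (r := bitSign _),
    ← Finset.sum_add_distrib, Finset.card_insert_of_notMem hj, pow_succ, mul_div_right_comm,
    ← smul_smul, Finset.smul_sum (r := (2 : ℂ))]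
  simp only [hbit]

variable [Fintype α] [Fintype β] {ρ : (ι → ZMod 2) → Matrix α α ℂ}
  {H : (ι → ZMod 2) → Matrix α β ℂ} (h : IsErrorExpansion ρ H)

include h

lemma IsErrorExpansion.condState_isHermitian (R : Matrix κ ι (ZMod 2)) (w : κ → ZMod 2)
    (s : Finset κ) : (condState ρ R w s).IsHermitian := by
  simp only [condState, h.eq_mul_conjTranspose]
  rw [Matrix.IsHermitian, Matrix.conjTranspose_smul, Matrix.conjTranspose_sum, star_div₀, star_pow,
    star_pow, star_ofNat]
  simp only [Matrix.conjTranspose_mul, Matrix.conjTranspose_conjTranspose]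

variable [DecidableEq α] {S : Matrix α α ℂ}

lemma IsErrorExpansion.dist_trace_condState_insert_le [DecidableEq κ]
    (hS : S ∈ Matrix.unitaryGroup α ℂ) {R : Matrix κ ι (ZMod 2)}
    (hR : LinearIndependent (ZMod 2) R.row) (w : κ → ZMod 2) {s : Finset κ} {j : κ} (hj : j ∉ s)
    {D : ℕ} (hD : ∀ u ∈ Submodule.span (ZMod 2) (R.row '' s), D ≤ hammingDist (R.row j) u) :
    dist (S * condState ρ R w s).trace (S * condState ρ R w (insert j s)).trace ≤
      2 * √(tailWeight (fun d => ‖H d‖ ^ 2) D) := by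
  rw [condState_insert ρ R w hj, Matrix.mul_add, Matrix.trace_add, dist_self_add_right,
    Matrix.mul_smul, Matrix.trace_smul, norm_smul, norm_bitSign, one_mul, condState_eq_submatrix]
  have hRs : LinearIndependent (ZMod 2) (R.submatrix ((↑) : s → κ) id).row :=
    hR.comp _ Subtype.val_injective
  refine h.norm_trace_mul_smul_sum_le hRs _ (fun t => hD _ ?_) hS
  rw [Matrix.vecMul_eq_sum]
  exact Submodule.sum_mem _ fun i _ => Submodule.smul_mem _ _
    (Submodule.subset_span (Set.mem_image_of_mem _ i.2))

lemma IsErrorExpansion.dist_trace_condState_univ_le (hS : S ∈ Matrix.unitaryGroup α ℂ) {r m : ℕ}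
    {R : Matrix (Fin (r + m)) ι (ZMod 2)} (hR : LinearIndependent (ZMod 2) R.row)
    (w : Fin (r + m) → ZMod 2) {D : ℕ}
    (hD : ∀ j : Fin (r + m), r ≤ (j : ℕ) →
      ∀ u ∈ Submodule.span (ZMod 2) (R.row '' {i | i < j}), D ≤ hammingDist (R.row j) u) :
    dist (S * condState ρ R w {i | (i : ℕ) < r}).trace
        (S * condState ρ R w Finset.univ).trace ≤
      2 * m * √(tailWeight (fun d => ‖H d‖ ^ 2) D) := by
  have step (j : ℕ) (hrj : r ≤ j) (hjm : j < r + m) :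
      dist (S * condState ρ R w {i | (i : ℕ) < j}).trace
          (S * condState ρ R w {i | (i : ℕ) < j + 1}).trace ≤
        2 * √(tailWeight (fun d => ‖H d‖ ^ 2) D) := by
    have hinsert : ({i | (i : ℕ) < j + 1} : Finset (Fin (r + m))) =
        insert ⟨j, hjm⟩ ({i | (i : ℕ) < j} : Finset (Fin (r + m))) := by
      ext i
      simp only [Finset.mem_filter_univ, Finset.mem_insert, Fin.ext_iff]
      omega
    rw [hinsert]
    refine h.dist_trace_condState_insert_le hS hR w (by simp) ?_
    rw [Finset.coe_filter_univ]
    exact hD ⟨j, hjm⟩ hrj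
  have huniv : ({i | (i : ℕ) < r + m} : Finset (Fin (r + m))) = Finset.univ := by simp
  have telescope := dist_le_Ico_sum_of_dist_le (Nat.le_add_right r m) fun {j} => step j
  rw [huniv, Finset.sum_const, Nat.card_Ico, nsmul_eq_mul] at telescope
  exact telescope.trans_eq (by rw [Nat.add_sub_cancel_left]; ring)

/-- Both states are compared with the one in which only the common first `r` parities are known. -/
lemma IsErrorExpansion.traceDist_condState_univ_le {r m : ℕ}
    {R : Matrix (Fin (r + m)) ι (ZMod 2)} (hR : LinearIndependent (ZMod 2) R.row)
    {w w' : Fin (r + m) → ZMod 2} (hw : ∀ i : Fin (r + m), (i : ℕ) < r → w i = w' i) {D : ℕ}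
    (hD : ∀ j : Fin (r + m), r ≤ (j : ℕ) →
      ∀ u ∈ Submodule.span (ZMod 2) (R.row '' {i | i < j}), D ≤ hammingDist (R.row j) u) :
    traceDist (condState ρ R w Finset.univ) (condState ρ R w' Finset.univ) ≤
      2 * m * √(tailWeight (fun d => ‖H d‖ ^ 2) D) := by
  refine traceDist_le_of_forall_unitary (h.condState_isHermitian _ _ _)
    (h.condState_isHermitian _ _ _) fun S hS => ?_
  have hcommon : condState ρ R w {i | (i : ℕ) < r} = condState ρ R w' {i | (i : ℕ) < r} :=
    condState_congr ρ R fun i hi => hw i (Finset.mem_filter_univ i |>.mp hi)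
  refine (dist_triangle_left _ _ (S * condState ρ R w {i | (i : ℕ) < r}).trace).trans ?_
  rw [two_mul (2 * (m : ℝ) * _)]
  refine add_le_add (h.dist_trace_condState_univ_le hS hR w hD) ?_
  rw [hcommon]
  exact h.dist_trace_condState_univ_le hS hR w' hD

end Key

lemma minDist_le_hammingDist {n r m : ℕ} (PC : Matrix (Fin r) (Fin n) (ZMod 2))
    (PK : Matrix (Fin m) (Fin n) (ZMod 2)) {j : Fin (r + m)} (hj : r ≤ (j : ℕ)) {u : BitString n}
    (hu : u ∈ Submodule.span (ZMod 2) (codeRows PC PK '' {i | i < j})) :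
    minDist PC PK ≤ hammingDist (codeRows PC PK j) u :=
  (Nat.sInf_le ⟨j, hj, rfl⟩ : minDist PC PK ≤ distToSubspace (codeRows PC PK j) _).trans
    (Nat.sInf_le ⟨u, hu, rfl⟩)

lemma forall_codeRows_mulVec_eq_append_iff {n r m : ℕ} (PC : Matrix (Fin r) (Fin n) (ZMod 2))
    (PK : Matrix (Fin m) (Fin n) (ZMod 2)) (x : BitString n) (ξ : BitString r) (k : BitString m) :
    (∀ i, (Matrix.of (codeRows PC PK) *ᵥ x) i = Fin.append ξ k i) ↔
      PC *ᵥ x = ξ ∧ PK *ᵥ x = k := by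
  have hl (i : Fin r) : (Matrix.of (codeRows PC PK) *ᵥ x) (Fin.castAdd m i) = (PC *ᵥ x) i :=
    congrArg (· ⬝ᵥ x) (Fin.append_left PC.row PK.row i)
  have hr (i : Fin m) : (Matrix.of (codeRows PC PK) *ᵥ x) (Fin.natAdd r i) = (PK *ᵥ x) i :=
    congrArg (· ⬝ᵥ x) (Fin.append_right PC.row PK.row i)
  simp only [Fin.forall_fin_add, hl, hr, Fin.append_left, Fin.append_right, funext_iff]

lemma eveKeyState_eq_condState {n nz nx r m : ℕ} (A : CollectiveAttack (n + nz + nx))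
    (P : BitPartition n nz nx) {PC : Matrix (Fin r) (Fin n) (ZMod 2)}
    {PK : Matrix (Fin m) (Fin n) (ZMod 2)} (hrows : LinearIndependent (ZMod 2) (codeRows PC PK))
    (ξ : BitString r) (k : BitString m) :
    eveKeyState A P PC PK ξ k =
      condState (eveState A P) (Matrix.of (codeRows PC PK)) (Fin.append ξ k) Finset.univ := by
  have hle : r + m ≤ n := by simpa using hrows.fintype_card_le_finrank
  simp only [eveKeyState, condState, Finset.mem_univ, true_imp_iff,
    forall_codeRows_mulVec_eq_append_iff]
  rw [Nat.sub_sub, pow_sub₀ _ two_ne_zero hle, mul_inv, inv_inv, mul_comm, ← div_eq_mul_inv,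
    Finset.card_univ, Fintype.card_fin, Fintype.card_fin]

open scoped Matrix.Norms.Frobenius in
lemma traceDist_eveKeyState_le {n nz nx r m : ℕ} {A : CollectiveAttack (n + nz + nx)}
    {P : BitPartition n nz nx} {β : Type*} [Fintype β]
    {H : BitString n → Matrix (EveIndex A P) β ℂ} (h : IsErrorExpansion (eveState A P) H)
    {PC : Matrix (Fin r) (Fin n) (ZMod 2)} {PK : Matrix (Fin m) (Fin n) (ZMod 2)}
    (hrows : LinearIndependent (ZMod 2) (codeRows PC PK)) (ξ : BitString r) (k k' : BitString m) :
    traceDist (eveKeyState A P PC PK ξ k) (eveKeyState A P PC PK ξ k') ≤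
      2 * m * √(tailWeight (fun d => ‖H d‖ ^ 2) (minDist PC PK)) := by
  rw [eveKeyState_eq_condState A P hrows, eveKeyState_eq_condState A P hrows]
  refine h.traceDist_condState_univ_le hrows (fun i hi => ?_)
    fun j hj u hu => minDist_le_hammingDist PC PK hj hu
  obtain ⟨i, rfl⟩ : ∃ i', i = Fin.castAdd m i' := ⟨⟨i, hi⟩, rfl⟩
  rw [Fin.append_left, Fin.append_left]

/-! ## Tensor products -/

section PiMatrix

variable {ι : Type*} [Fintype ι] {α β γ : ι → Type*}

/-- The tensor product of a family of matrices. -/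
def piMatrix (A : ∀ l, Matrix (α l) (β l) ℂ) : Matrix (∀ l, α l) (∀ l, β l) ℂ :=
  Matrix.of fun f g => ∏ l, A l (f l) (g l)

lemma conjTranspose_piMatrix (A : ∀ l, Matrix (α l) (β l) ℂ) :
    (piMatrix A)ᴴ = piMatrix fun l => (A l)ᴴ := by
  ext f g
  exact map_prod (starRingEnd ℂ) _ _

variable [DecidableEq ι]

lemma piMatrix_mul [∀ l, Fintype (β l)] (A : ∀ l, Matrix (α l) (β l) ℂ)
    (B : ∀ l, Matrix (β l) (γ l) ℂ) :
    piMatrix A * piMatrix B = piMatrix fun l => A l * B l := by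
  ext f g
  simp only [piMatrix, Matrix.of_apply, Matrix.mul_apply, Fintype.prod_sum, Finset.prod_mul_distrib]

lemma trace_piMatrix [∀ l, Fintype (α l)] (A : ∀ l, Matrix (α l) (α l) ℂ) :
    (piMatrix A).trace = ∏ l, (A l).trace := by
  simp only [Matrix.trace, Matrix.diag, piMatrix, Matrix.of_apply, Fintype.prod_sum]

lemma walshTransform_piMatrix (η : ∀ l, ZMod 2 → Matrix (α l) (β l) ℂ) (x : ι → ZMod 2) :
    walshTransform (fun d => piMatrix fun l => η l (d l)) x =
      piMatrix fun l => ∑ b, bitSign (x l * b) • η l b := by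
  ext f g
  simp only [walshTransform, Matrix.sum_apply, Matrix.smul_apply, piMatrix, Matrix.of_apply,
    smul_eq_mul, Fintype.prod_sum, bitSign_dotProduct, Finset.prod_mul_distrib]

open scoped Matrix.Norms.Frobenius

lemma frobenius_norm_sq_piMatrix [∀ l, Fintype (α l)] [∀ l, Fintype (β l)]
    (A : ∀ l, Matrix (α l) (β l) ℂ) : ‖piMatrix A‖ ^ 2 = ∏ l, ‖A l‖ ^ 2 := by
  simp only [frobenius_norm_sq, piMatrix, Matrix.of_apply, norm_prod, Finset.prod_pow,
    Fintype.prod_sum]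

/-- The analogue of `IsErrorExpansion` for the two states of an adversary who attacks a single
bit. -/
structure IsBitErrorExpansion {α β : Type*} [Fintype α] [Fintype β] (ρ : ZMod 2 → Matrix α α ℂ)
    (η : ZMod 2 → Matrix α β ℂ) : Prop where
  eq_mul_conjTranspose : ∀ a,
    ρ a = (∑ b, bitSign (a * b) • η b) * (∑ b, bitSign (a * b) • η b)ᴴ
  orthogonal : Pairwise fun b b' => (η b * (η b')ᴴ).trace = 0
  sum_norm_sq : ∑ b, ‖η b‖ ^ 2 = 1

lemma IsErrorExpansion.piMatrix [∀ l, Fintype (α l)] [∀ l, Fintype (β l)]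
    {ρ : ∀ l, ZMod 2 → Matrix (α l) (α l) ℂ} {η : ∀ l, ZMod 2 → Matrix (α l) (β l) ℂ}
    (h : ∀ l, IsBitErrorExpansion (ρ l) (η l)) :
    IsErrorExpansion (fun x : ι → ZMod 2 => piMatrix fun l => ρ l (x l))
      fun d => piMatrix fun l => η l (d l) where
  eq_mul_conjTranspose x := by
    simp only [walshTransform_piMatrix, conjTranspose_piMatrix, piMatrix_mul,
      (h _).eq_mul_conjTranspose]
  orthogonal d d' hdd' := by
    obtain ⟨l, hl⟩ := Function.ne_iff.mp hdd'
    rw [conjTranspose_piMatrix, piMatrix_mul, trace_piMatrix]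
    exact Finset.prod_eq_zero (Finset.mem_univ l) ((h l).orthogonal hl)
  sum_norm_sq := by
    simp only [frobenius_norm_sq_piMatrix, ← Fintype.prod_sum fun l b => ‖η l b‖ ^ 2,
      (h _).sum_norm_sq, Finset.prod_const_one]

end PiMatrix

/-! ## Error expansions of a pair of states -/

section Purification

open scoped Matrix.Norms.Frobenius

variable {α τ : Type*} [Fintype α] [Fintype τ]

lemma frobenius_norm_sq_add_bitSign_smul (A B : Matrix α τ ℂ) (b : ZMod 2) :
    ‖A + bitSign b • B‖ ^ 2 = ‖A‖ ^ 2 + ‖B‖ ^ 2 + 2 * (bitSign b * (A * Bᴴ).trace).re := by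
  have hBA : (B * Aᴴ).trace = star (A * Bᴴ).trace := by
    rw [← Matrix.trace_conjTranspose, Matrix.conjTranspose_mul, Matrix.conjTranspose_conjTranspose]
  have key : ((‖A + bitSign b • B‖ ^ 2 : ℝ) : ℂ) =
      ‖A‖ ^ 2 + ‖B‖ ^ 2 + (bitSign b * (A * Bᴴ).trace + star (bitSign b * (A * Bᴴ).trace)) := by
    simp only [← Complex.ofReal_pow, ← trace_mul_conjTranspose_self, Matrix.conjTranspose_add,
      Matrix.conjTranspose_smul, Matrix.add_mul, Matrix.mul_add, Matrix.trace_add, Matrix.smul_mul,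
      Matrix.mul_smul, Matrix.trace_smul, smul_eq_mul, star_bitSign, hBA, star_mul']
    linear_combination (B * Bᴴ).trace * bitSign_mul_self b
  rw [RCLike.star_def, Complex.add_conj] at key
  exact_mod_cast key

/-- With two copies of the auxiliary system, the second state can be spread over both, which shrinks
the overlap to its real part. -/
lemma exists_purification_trace_eq_re (X : ZMod 2 → Matrix α τ ℂ) :
    ∃ M : ZMod 2 → Matrix α (τ ⊕ τ) ℂ, (∀ a, M a * (M a)ᴴ = X a * (X a)ᴴ) ∧
      (M 0 * (M 1)ᴴ).trace = ((X 0 * (X 1)ᴴ).trace.re : ℂ) := by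
  set g := (X 0 * (X 1)ᴴ).trace
  obtain ⟨c, hc1, hc⟩ : ∃ c : ℂ, ‖c‖ ≤ 1 ∧ star c * g = (g.re : ℂ) := by
    refine ⟨g.re / star g, ?_, ?_⟩
    · rw [norm_div, norm_star, Complex.norm_real, Real.norm_eq_abs]
      exact div_le_one_of_le₀ (Complex.abs_re_le_norm g) (norm_nonneg g)
    · rw [star_div₀, star_star, RCLike.star_def, Complex.conj_ofReal]
      exact div_mul_cancel_of_imp fun h => by rw [h, Complex.zero_re, Complex.ofReal_zero]
  obtain ⟨s, hcs⟩ : ∃ s : ℂ, star c * c + star s * s = 1 := by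
    have hs : 0 ≤ 1 - ‖c‖ ^ 2 := sub_nonneg.mpr (pow_le_one₀ (norm_nonneg c) hc1)
    refine ⟨((√(1 - ‖c‖ ^ 2) : ℝ) : ℂ), ?_⟩
    rw [RCLike.star_def, Complex.conj_ofReal, Complex.conj_mul',
      ← Complex.ofReal_mul, Real.mul_self_sqrt hs]
    push_cast
    ring
  let M : ZMod 2 → Matrix α (τ ⊕ τ) ℂ :=
    ![Matrix.fromCols (X 0) 0, Matrix.fromCols (c • X 1) (s • X 1)]
  have hM0 : M 0 = Matrix.fromCols (X 0) 0 := rfl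
  have hM1 : M 1 = Matrix.fromCols (c • X 1) (s • X 1) := rfl
  refine ⟨M, fun a => ?_, ?_⟩
  · rcases zmod_two_eq_zero_or_one a with rfl | rfl
    · rw [hM0, Matrix.conjTranspose_fromCols_eq_fromRows_conjTranspose,
        Matrix.fromCols_mul_fromRows, Matrix.zero_mul, add_zero]
    · rw [hM1, Matrix.conjTranspose_fromCols_eq_fromRows_conjTranspose,
        Matrix.fromCols_mul_fromRows]
      simp only [Matrix.conjTranspose_smul, Matrix.smul_mul, Matrix.mul_smul]
      rw [smul_smul, smul_smul, ← add_smul, hcs, one_smul]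
  · rw [hM0, hM1, Matrix.conjTranspose_fromCols_eq_fromRows_conjTranspose,
      Matrix.fromCols_mul_fromRows, Matrix.zero_mul, add_zero, Matrix.conjTranspose_smul,
      Matrix.mul_smul, Matrix.trace_smul, smul_eq_mul, hc]

lemma isBitErrorExpansion_of_trace_im_eq_zero {M : ZMod 2 → Matrix α τ ℂ} (hM : ∀ a, ‖M a‖ = 1)
    (him : (M 0 * (M 1)ᴴ).trace.im = 0) :
    IsBitErrorExpansion (fun a => M a * (M a)ᴴ)
      fun b => (1 / 2 : ℂ) • (M 0 + bitSign b • M 1) where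
  eq_mul_conjTranspose a := by
    have inversion : ∑ b, bitSign (a * b) • (1 / 2 : ℂ) • (M 0 + bitSign b • M 1) = M a := by
      rw [sum_zmod_two]
      rcases zmod_two_eq_zero_or_one a with rfl | rfl <;>
        simp only [mul_zero, mul_one, AddChar.map_zero_eq_one, bitSign_one] <;>
        module
    rw [inversion]
  orthogonal b b' hb := by
    have hM10 : (M 1 * (M 0)ᴴ).trace = (M 0 * (M 1)ᴴ).trace := by
      rw [← Complex.conj_eq_iff_im.mpr him, ← RCLike.star_def, ← Matrix.trace_conjTranspose,
        Matrix.conjTranspose_mul, Matrix.conjTranspose_conjTranspose]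
    have hs : bitSign b' = -bitSign b := by
      rcases zmod_two_eq_zero_or_one b with rfl | rfl <;>
        rcases zmod_two_eq_zero_or_one b' with rfl | rfl <;> simp at hb ⊢
    simp only [hs, Matrix.conjTranspose_add, Matrix.conjTranspose_smul, Matrix.add_mul,
      Matrix.mul_add, Matrix.trace_add, Matrix.smul_mul, Matrix.mul_smul, Matrix.trace_smul,
      smul_eq_mul, star_neg, star_bitSign, hM10, trace_mul_conjTranspose_self, hM]
    push_cast
    linear_combination (-(1 / 2 * star (1 / 2 : ℂ))) * bitSign_mul_self b
  sum_norm_sq := by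
    simp only [norm_smul, mul_pow, frobenius_norm_sq_add_bitSign_smul, hM, sum_zmod_two,
      AddChar.map_zero_eq_one, bitSign_one, neg_mul, Complex.neg_re]
    norm_num
    ring

lemma exists_isBitErrorExpansion {X : ZMod 2 → Matrix α τ ℂ} (hX : ∀ a, ‖X a‖ = 1) :
    ∃ η : ZMod 2 → Matrix α (τ ⊕ τ) ℂ, IsBitErrorExpansion (fun a => X a * (X a)ᴴ) η ∧
      ∀ b, ‖η b‖ ^ 2 = ‖X 0 + bitSign b • X 1‖ ^ 2 / 4 := by
  obtain ⟨M, hM, hre⟩ := exists_purification_trace_eq_re X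
  have hnorm (a : ZMod 2) : ‖M a‖ = 1 := by
    have hsq : ‖M a‖ ^ 2 = ‖X a‖ ^ 2 := Complex.ofReal_injective <| by
      rw [← trace_mul_conjTranspose_self, hM, trace_mul_conjTranspose_self]
    rw [← hX a]
    exact (sq_eq_sq₀ (norm_nonneg _) (norm_nonneg _)).mp hsq
  have hexp := isBitErrorExpansion_of_trace_im_eq_zero hnorm (by rw [hre, Complex.ofReal_im])
  simp only [hM] at hexp
  refine ⟨_, hexp, fun b => ?_⟩
  have hreal : (bitSign b * (M 0 * (M 1)ᴴ).trace).re = (bitSign b * (X 0 * (X 1)ᴴ).trace).re := by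
    rcases zmod_two_eq_zero_or_one b with rfl | rfl <;> simp [hre]
  rw [norm_smul, mul_pow, frobenius_norm_sq_add_bitSign_smul, frobenius_norm_sq_add_bitSign_smul,
    hreal, hnorm, hnorm, hX, hX]
  norm_num
  ring

end Purification

/-! ## A single attacked qubit -/

lemma sum_norm_sq_sum_bitSign_mul (z : ZMod 2 → ℂ) :
    ∑ a, ‖∑ t, bitSign (a * t) * z t‖ ^ 2 = 2 * ∑ t, ‖z t‖ ^ 2 := by
  have parallelogram := parallelogram_law_with_norm ℝ (z 0) (z 1)
  simp only [sum_zmod_two, mul_zero, mul_one, AddChar.map_zero_eq_one, bitSign_one, one_mul,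
    neg_one_mul, ← sub_eq_add_neg]
  linear_combination parallelogram

lemma ket_zero (a t : ZMod 2) : ket 0 a t = if t = a then 1 else 0 :=
  if_pos rfl

lemma ket_one (a t : ZMod 2) : ket 1 a t = (√2 : ℂ)⁻¹ * bitSign (a * t) := by
  rcases zmod_two_eq_zero_or_one a with rfl | rfl <;>
    rcases zmod_two_eq_zero_or_one t with rfl | rfl <;> simp [ket, neg_div]

lemma norm_sq_inv_sqrt_two : ‖(√2 : ℂ)⁻¹‖ ^ 2 = 1 / 2 := by
  rw [norm_inv, Complex.norm_real, Real.norm_eq_abs, inv_pow, sq_abs, Real.sq_sqrt zero_le_two,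
    one_div]

lemma star_ket (β a t : ZMod 2) : star (ket β a t) = ket β a t := by
  rcases zmod_two_eq_zero_or_one β with rfl | rfl
  · rw [ket_zero, apply_ite star, star_one, star_zero]
  · rw [ket_one, star_mul', star_bitSign, RCLike.star_def, map_inv₀, Complex.conj_ofReal]

lemma ket_comm (β a t : ZMod 2) : ket β a t = ket β t a := by
  rcases zmod_two_eq_zero_or_one β with rfl | rfl
  · simp only [ket_zero, eq_comm]
  · rw [ket_one, ket_one, mul_comm a]

lemma sum_norm_sq_sum_ket_mul (β : ZMod 2) (z : ZMod 2 → ℂ) :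
    ∑ y, ‖∑ t, ket β y t * z t‖ ^ 2 = ∑ t, ‖z t‖ ^ 2 := by
  rcases zmod_two_eq_zero_or_one β with rfl | rfl
  · simp only [ket_zero, ite_mul, one_mul, zero_mul, Finset.sum_ite_eq', Finset.mem_univ, if_true]
  · simp only [ket_one, mul_assoc, ← Finset.mul_sum, norm_mul, mul_pow, norm_sq_inv_sqrt_two,
      sum_norm_sq_sum_bitSign_mul]
    ring

lemma sum_norm_sq_ket (β a : ZMod 2) : ∑ t, ‖ket β a t‖ ^ 2 = 1 := by
  have parseval := sum_norm_sq_sum_ket_mul β (Pi.single a 1)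
  simpa [ket_comm β _ a, Pi.single_apply, apply_ite] using parseval

lemma sum_norm_sq_mulVec_of_mem_unitaryGroup {ν : Type*} [Fintype ν] [DecidableEq ν]
    {U : Matrix ν ν ℂ} (hU : U ∈ Matrix.unitaryGroup ν ℂ) (v : ν → ℂ) :
    ∑ p, ‖(U *ᵥ v) p‖ ^ 2 = ∑ p, ‖v p‖ ^ 2 := by
  have hstar (u : ν → ℂ) : ((∑ p, ‖u p‖ ^ 2 : ℝ) : ℂ) = star u ⬝ᵥ u := by
    simp only [dotProduct, Complex.ofReal_sum, Pi.star_apply, RCLike.star_def, Complex.conj_mul',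
      Complex.ofReal_pow]
  refine Complex.ofReal_injective ?_
  rw [hstar, hstar, Matrix.star_mulVec, ← Matrix.dotProduct_mulVec, Matrix.mulVec_mulVec,
    ← Matrix.star_eq_conjTranspose, Matrix.mem_unitaryGroup_iff'.mp hU, Matrix.one_mulVec]

namespace CollectiveAttack

variable {N : ℕ} (A : CollectiveAttack N)

lemma sum_norm_sq_evolved (j : Fin N) (β a : ZMod 2) :
    ∑ e, ∑ t, ‖A.evolved j β a (e, t)‖ ^ 2 = 1 := by
  rw [← Fintype.sum_prod_type fun p => ‖A.evolved j β a p‖ ^ 2]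
  simp only [evolved]
  rw [sum_norm_sq_mulVec_of_mem_unitaryGroup (A.U j).2, Fintype.sum_prod_type]
  simp only [norm_mul, mul_pow, ← Finset.mul_sum, sum_norm_sq_ket, mul_one]
  exact A.init_normalized j

lemma bobProb_nonneg (j : Fin N) (β a y : ZMod 2) : 0 ≤ A.bobProb j β a y :=
  Finset.sum_nonneg fun _ _ => sq_nonneg _

lemma sum_bobProb (j : Fin N) (β a : ZMod 2) : ∑ y, A.bobProb j β a y = 1 := by
  simp only [bobProb, probeVec, star_ket]
  rw [Finset.sum_comm]
  simp only [sum_norm_sq_sum_ket_mul]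
  exact A.sum_norm_sq_evolved j β a

/-- The probability of the error `c` in the `j`-th bit, for a uniformly random bit encoded and
measured in the basis `β`. -/
def errProb (j : Fin N) (β c : ZMod 2) : ℝ := (∑ a, A.bobProb j β a (a + c)) / 2

lemma errProb_nonneg (j : Fin N) (β c : ZMod 2) : 0 ≤ A.errProb j β c :=
  div_nonneg (Finset.sum_nonneg fun _ _ => A.bobProb_nonneg _ _ _ _) zero_le_two

lemma sum_errProb (j : Fin N) (β : ZMod 2) : ∑ c, A.errProb j β c = 1 := by
  have hshift (a : ZMod 2) : ∑ c, A.bobProb j β a (a + c) = 1 :=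
    (Equiv.sum_comp (Equiv.addLeft a) (A.bobProb j β a)).trans (A.sum_bobProb j β a)
  simp only [errProb]
  rw [← Finset.sum_div, Finset.sum_comm]
  simp [hshift]

/-- The joint state of the `j`-th probe and the `j`-th qubit, as a matrix, with the qubit flipped
if Alice sent `|1⟩`: undoing Alice's choice aligns the error-free components of both states. -/
def aligned (j : Fin N) (a : ZMod 2) : Matrix (Fin (A.dim j)) (ZMod 2) ℂ :=
  Matrix.of fun e t => A.evolved j 0 a (e, t + a)

lemma aligned_mul_conjTranspose (j : Fin N) (a : ZMod 2) :
    A.aligned j a * (A.aligned j a)ᴴ = A.probeState j 0 a := by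
  ext e e'
  exact Equiv.sum_comp (Equiv.addRight a)
    fun t => A.evolved j 0 a (e, t) * star (A.evolved j 0 a (e', t))

lemma evolved_one (j : Fin N) (a : ZMod 2) (p : Fin (A.dim j) × ZMod 2) :
    A.evolved j 1 a p = (√2 : ℂ)⁻¹ * ∑ u, bitSign (a * u) * A.evolved j 0 u p := by
  have hket (t : ZMod 2) : ket 1 a t = (√2 : ℂ)⁻¹ * ∑ u, bitSign (a * u) * ket 0 u t := by
    simp only [ket_one, ket_zero, mul_ite, mul_one, mul_zero, Finset.sum_ite_eq, Finset.mem_univ,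
      if_true]
  simp only [evolved, Matrix.mulVec, dotProduct, hket, Finset.mul_sum]
  rw [Finset.sum_comm]
  refine Finset.sum_congr rfl fun u _ => Finset.sum_congr rfl fun q _ => ?_
  ring

lemma probeVec_one_add (j : Fin N) (a c : ZMod 2) (e : Fin (A.dim j)) :
    A.probeVec j 1 a (a + c) e = (1 / 2) *
      ∑ s, bitSign (a * s) * (bitSign (c * s) *
        (A.aligned j 0 + bitSign c • A.aligned j 1) e s) := by
  have hhalf : (√2 : ℂ)⁻¹ * (√2 : ℂ)⁻¹ = 1 / 2 := by
    rw [← mul_inv, ← Complex.ofReal_mul, Real.mul_self_sqrt zero_le_two]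
    norm_num
  have hself : (1 + 1 : ZMod 2) = 0 := ZModModule.add_self 1
  simp only [probeVec, star_ket]
  simp only [ket_one, evolved_one, sum_zmod_two, aligned, Matrix.add_apply, Matrix.smul_apply,
    Matrix.of_apply, smul_eq_mul, mul_zero, mul_one, add_zero, zero_add, hself,
    AddChar.map_zero_eq_one, AddChar.map_add_eq_mul, one_mul, ← hhalf]
  linear_combination (√2 : ℂ)⁻¹ * (√2 : ℂ)⁻¹ *
    (bitSign c * A.evolved j 0 1 (e, 1) * bitSign_mul_self a -
      bitSign a * A.evolved j 0 1 (e, 0) * bitSign_mul_self c)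

open scoped Matrix.Norms.Frobenius

lemma norm_aligned (j : Fin N) (a : ZMod 2) : ‖A.aligned j a‖ = 1 := by
  rw [← sq_eq_sq₀ (norm_nonneg _) zero_le_one, one_pow, frobenius_norm_sq,
    ← A.sum_norm_sq_evolved j 0 a]
  exact Finset.sum_congr rfl fun e _ =>
    Equiv.sum_comp (Equiv.addRight a) fun t => ‖A.evolved j 0 a (e, t)‖ ^ 2

lemma errProb_one (j : Fin N) (c : ZMod 2) :
    A.errProb j 1 c = ‖A.aligned j 0 + bitSign c • A.aligned j 1‖ ^ 2 / 4 := by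
  simp only [errProb, bobProb, probeVec_one_add, norm_mul, mul_pow]
  rw [Finset.sum_comm, frobenius_norm_sq, Finset.sum_div, Finset.sum_div]
  refine Finset.sum_congr rfl fun e _ => ?_
  rw [← Finset.mul_sum, sum_norm_sq_sum_bitSign_mul]
  simp only [norm_mul, norm_bitSign, one_mul]
  norm_num
  ring

lemma exists_isBitErrorExpansion_probeState (j : Fin N) :
    ∃ η : ZMod 2 → Matrix (Fin (A.dim j)) (ZMod 2 ⊕ ZMod 2) ℂ,
      IsBitErrorExpansion (A.probeState j 0) η ∧ ∀ c, ‖η c‖ ^ 2 = A.errProb j 1 c := by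
  obtain ⟨η, hη, hnorm⟩ := exists_isBitErrorExpansion (A.norm_aligned j)
  simp only [aligned_mul_conjTranspose] at hη
  exact ⟨η, hη, fun c => by rw [hnorm, errProb_one]⟩

end CollectiveAttack

/-! ## Splitting the bits according to a partition -/

lemma mem_range_positions {N k : ℕ} {s : BitString N} (hs : hammingNorm s = k) {j : Fin N} :
    j ∈ Set.range (positions s hs) ↔ s j ≠ 0 := by
  have hrange : Set.range (positions s hs) = (Finset.univ.filter fun j => s j ≠ 0) :=
    Finset.range_orderEmbOfFin _ hs
  rw [hrange, Finset.mem_coe, Finset.mem_filter_univ]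

lemma apply_positions {N k : ℕ} {s : BitString N} (hs : hammingNorm s = k) (l : Fin k) :
    s (positions s hs l) = 1 :=
  (zmod_two_eq_zero_or_one _).resolve_left ((mem_range_positions hs).mp ⟨l, rfl⟩)

lemma eq_zero_of_forall_positions_ne {N k : ℕ} {s : BitString N} (hs : hammingNorm s = k)
    {j : Fin N} (hj : ∀ l, positions s hs l ≠ j) : s j = 0 := by
  by_contra hne
  obtain ⟨l, hl⟩ := (mem_range_positions hs).mpr hne
  exact hj l hl

namespace BitPartition

variable {n nz nx : ℕ} (P : BitPartition n nz nx)

/-- The position, among all the bits, of the `l`-th TEST-Z bit. -/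
def testZPos (l : Fin nz) : Fin (n + nz + nx) := positions P.z P.weight_z l

/-- The position, among all the bits, of the `l`-th TEST-X bit. -/
def testXPos (l : Fin nx) : Fin (n + nz + nx) := positions P.b P.weight_b l

/-- The map that lists the positions of the INFO bits, of the TEST-Z bits and of the TEST-X bits,
in this order. -/
def position : Fin n ⊕ Fin nz ⊕ Fin nx → Fin (n + nz + nx) :=
  Sum.elim P.infoPos (Sum.elim P.testZPos P.testXPos)

lemma add_apply_ne_zero (j : Fin (n + nz + nx)) : (P.s + P.z + P.b) j ≠ 0 := by
  have huniv : (Finset.univ.filter fun j => (P.s + P.z + P.b) j ≠ 0) = Finset.univ := by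
    rw [← Finset.card_eq_iff_eq_univ, Fintype.card_fin]
    exact P.weight_add
  exact Finset.mem_filter_univ j |>.mp (huniv ▸ Finset.mem_univ j)

lemma position_bijective : Function.Bijective P.position := by
  rw [Fintype.bijective_iff_surjective_and_card]
  refine ⟨fun j => ?_, by simp [add_assoc]⟩
  by_contra! hj
  refine P.add_apply_ne_zero j ?_
  rw [Pi.add_apply, Pi.add_apply,
    eq_zero_of_forall_positions_ne P.weight_s fun l => hj (.inl l),
    eq_zero_of_forall_positions_ne P.weight_z fun l => hj (.inr (.inl l)),
    eq_zero_of_forall_positions_ne P.weight_b fun l => hj (.inr (.inr l)), add_zero, add_zero]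

lemma s_infoPos (l : Fin n) : P.s (P.infoPos l) = 1 := apply_positions _ l

lemma s_testZPos (l : Fin nz) : P.s (P.testZPos l) = 0 :=
  eq_zero_of_forall_positions_ne P.weight_s fun l' =>
    P.position_bijective.1.ne (a₁ := .inl l') (a₂ := .inr (.inl l)) Sum.inl_ne_inr

lemma s_testXPos (l : Fin nx) : P.s (P.testXPos l) = 0 :=
  eq_zero_of_forall_positions_ne P.weight_s fun l' =>
    P.position_bijective.1.ne (a₁ := .inl l') (a₂ := .inr (.inr l)) Sum.inl_ne_inr

lemma b_infoPos (l : Fin n) : P.b (P.infoPos l) = 0 :=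
  eq_zero_of_forall_positions_ne P.weight_b fun l' =>
    P.position_bijective.1.ne (a₁ := .inr (.inr l')) (a₂ := .inl l) Sum.inr_ne_inl

lemma b_testZPos (l : Fin nz) : P.b (P.testZPos l) = 0 :=
  eq_zero_of_forall_positions_ne P.weight_b fun l' =>
    P.position_bijective.1.ne (a₁ := .inr (.inr l')) (a₂ := .inr (.inl l))
      (Sum.inr_injective.ne Sum.inr_ne_inl)

lemma b_testXPos (l : Fin nx) : P.b (P.testXPos l) = 1 := apply_positions _ l

lemma prod_eq_prod_position {M : Type*} [CommMonoid M] (F : Fin (n + nz + nx) → M) :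
    ∏ j, F j = (∏ l, F (P.infoPos l)) * ((∏ l, F (P.testZPos l)) * ∏ l, F (P.testXPos l)) := by
  rw [← P.position_bijective.prod_comp, Fintype.prod_sum_type, Fintype.prod_sum_type]
  rfl

lemma split_bijective :
    Function.Bijective fun c : BitString (n + nz + nx) => (P.info c, P.testZ c, P.testX c) := by
  rw [Fintype.bijective_iff_injective_and_card]
  refine ⟨fun c c' h => ?_, by simp [pow_add, mul_assoc]⟩
  simp only [Prod.mk.injEq] at h
  funext j
  obtain ⟨l | l | l, rfl⟩ := P.position_bijective.2 j
  exacts [congrFun h.1 l, congrFun h.2.1 l, congrFun h.2.2 l]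

lemma sum_split {R : Type*} [NonUnitalNonAssocSemiring R] (F : BitString n → R)
    (G : BitString nz → BitString nx → R) :
    ∑ c, F (P.info c) * G (P.testZ c) (P.testX c) = (∑ a, F a) * ∑ u, ∑ w, G u w := by
  rw [P.split_bijective.sum_comp fun p => F p.1 * G p.2.1 p.2.2, ← Fintype.sum_prod_type',
    Fintype.sum_mul_sum, Fintype.sum_prod_type]

end BitPartition

/-! ## Probabilities of strings of errors -/

namespace CollectiveAttack

section ErrorStrings

variable {N : ℕ} (A : CollectiveAttack N) {t : ℕ} (pos : Fin t → Fin N) (β : ZMod 2)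

/-- The probability of the string of errors `d` in the bits at the positions `pos`, for uniformly
random bits encoded and measured in the basis `β`. -/
def errStringProb (d : BitString t) : ℝ := ∏ l, A.errProb (pos l) β (d l)

lemma errStringProb_nonneg (d : BitString t) : 0 ≤ A.errStringProb pos β d :=
  Finset.prod_nonneg fun _ _ => A.errProb_nonneg _ _ _

lemma sum_errStringProb : ∑ d, A.errStringProb pos β d = 1 := by
  simp only [errStringProb, ← Fintype.prod_sum fun l c => A.errProb (pos l) β c, A.sum_errProb,
    Finset.prod_const_one]

lemma sum_prod_bobProb (b c : BitString N) :
    ∑ i : BitString N, ∏ j, A.bobProb j (b j) (i j) ((i + c) j) =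
      2 ^ N * ∏ j, A.errProb j (b j) (c j) := by
  simp only [Pi.add_apply, ← Fintype.prod_sum fun j a => A.bobProb j (b j) a (a + c j), errProb,
    Finset.prod_div_distrib, Finset.prod_const, Finset.card_univ, Fintype.card_fin]
  field_simp

end ErrorStrings

variable {n nz nx : ℕ} (A : CollectiveAttack (n + nz + nx)) (P : BitPartition n nz nx)

/-- The joint probability of the strings of errors `u` on the TEST-Z bits and `w` on the TEST-X
bits, given the partition `P`. -/
def testErrProb (u : BitString nz) (w : BitString nx) : ℝ :=
  A.errStringProb P.testZPos 0 u * A.errStringProb P.testXPos 1 w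

lemma testErrProb_nonneg (u : BitString nz) (w : BitString nx) : 0 ≤ A.testErrProb P u w :=
  mul_nonneg (A.errStringProb_nonneg _ _ _) (A.errStringProb_nonneg _ _ _)

lemma sum_testErrProb : ∑ u, ∑ w, A.testErrProb P u w = 1 := by
  simp only [testErrProb, ← Finset.sum_mul_sum, sum_errStringProb, mul_one]

open Classical in
/-- The probability that both tests are passed, given the partition `P`. -/
def passProb (paz pax : ℝ) : ℝ :=
  ∑ u, ∑ w, if errorRate u ≤ paz ∧ errorRate w ≤ pax then A.testErrProb P u w else 0

lemma passProb_nonneg (paz pax : ℝ) : 0 ≤ A.passProb P paz pax :=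
  Finset.sum_nonneg fun u _ => Finset.sum_nonneg fun w _ =>
    ite_nonneg (A.testErrProb_nonneg P u w) le_rfl

lemma passProb_le_one (paz pax : ℝ) : A.passProb P paz pax ≤ 1 := by
  rw [← A.sum_testErrProb P]
  refine Finset.sum_le_sum fun u _ => Finset.sum_le_sum fun w _ => ?_
  split_ifs
  exacts [le_rfl, A.testErrProb_nonneg P u w]

lemma sum_outcomeProb (bases : BitPartition n nz nx → BitString (n + nz + nx))
    (G : BitString (n + nz + nx) → ℝ) :
    ∑ i, ∑ iB, G (i + iB) * outcomeProb A bases P i iB =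
      (Fintype.card (BitPartition n nz nx) : ℝ)⁻¹ *
        ∑ c, G c * ∏ j, A.errProb j (bases P j) (c j) := by
  have hshift (i : BitString (n + nz + nx)) :
      ∑ iB, G (i + iB) * outcomeProb A bases P i iB =
        ∑ c, G c * outcomeProb A bases P i (i + c) := by
    rw [← Equiv.sum_comp (Equiv.addLeft i)]
    refine Finset.sum_congr rfl fun c _ => ?_
    rw [Equiv.coe_addLeft, ← add_assoc, ZModModule.add_self, zero_add]
  simp only [hshift]
  rw [Finset.sum_comm, Finset.mul_sum]
  refine Finset.sum_congr rfl fun c _ => ?_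
  simp only [outcomeProb, ← Finset.mul_sum, sum_prod_bobProb]
  field_simp

lemma sum_outcomeProb_eq_mul {bases : BitPartition n nz nx → BitString (n + nz + nx)} {β : ZMod 2}
    (hinfo : ∀ l, bases P (P.infoPos l) = β) (htestZ : ∀ l, bases P (P.testZPos l) = 0)
    (htestX : ∀ l, bases P (P.testXPos l) = 1) (F : BitString n → ℝ)
    (G : BitString nz → BitString nx → ℝ) :
    ∑ i, ∑ iB, F (P.info (i + iB)) * G (P.testZ (i + iB)) (P.testX (i + iB)) *
        outcomeProb A bases P i iB =
      (Fintype.card (BitPartition n nz nx) : ℝ)⁻¹ *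
        ((∑ a, F a * A.errStringProb P.infoPos β a) * ∑ u, ∑ w, G u w * A.testErrProb P u w) := by
  have hprod (c : BitString (n + nz + nx)) : ∏ j, A.errProb j (bases P j) (c j) =
      A.errStringProb P.infoPos β (P.info c) * A.testErrProb P (P.testZ c) (P.testX c) := by
    rw [P.prod_eq_prod_position]
    simp only [hinfo, htestZ, htestX]
    rfl
  rw [A.sum_outcomeProb P bases fun c => F (P.info c) * G (P.testZ c) (P.testX c),
    ← P.sum_split (fun a => F a * A.errStringProb P.infoPos β a)
      fun u w => G u w * A.testErrProb P u w]
  simp only [hprod, mul_mul_mul_comm]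

end CollectiveAttack

section Events

variable {n nz nx : ℕ} (A : CollectiveAttack (n + nz + nx))

lemma eventProb_nonneg (bases : BitPartition n nz nx → BitString (n + nz + nx))
    (E : BitPartition n nz nx → BitString (n + nz + nx) → BitString (n + nz + nx) → Prop) :
    0 ≤ eventProb A bases E := by
  refine Finset.sum_nonneg fun P _ => Finset.sum_nonneg fun i _ => Finset.sum_nonneg fun iB _ => ?_
  split_ifs
  exacts [mul_nonneg (by positivity) (Finset.prod_nonneg fun j _ => A.bobProb_nonneg _ _ _ _),
    le_rfl]

lemma le_errorRate_iff {t : ℕ} (ht : 0 < t) (D : ℕ) (a : BitString t) :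
    (D : ℝ) / (2 * t) ≤ errorRate a ↔ D ≤ 2 * hammingNorm a := by
  have ht' : (0 : ℝ) < t := Nat.cast_pos.mpr ht
  rw [errorRate, div_le_div_iff₀ (by positivity) ht', ← mul_assoc, mul_le_mul_iff_left₀ ht',
    mul_comm]
  exact_mod_cast Iff.rfl

lemma eventProb_virtualBases (hn : 0 < n) (paz pax : ℝ) (D : ℕ) :
    eventProb A BitPartition.virtualBases (fun P i iB =>
        errorRate (P.info (i + iB)) ≥ (D : ℝ) / (2 * (n : ℝ)) ∧
          errorRate (P.testZ (i + iB)) ≤ paz ∧ errorRate (P.testX (i + iB)) ≤ pax) =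
      ∑ P, (Fintype.card (BitPartition n nz nx) : ℝ)⁻¹ *
        (tailWeight (A.errStringProb P.infoPos 1) D * A.passProb P paz pax) := by
  classical
  refine Finset.sum_congr rfl fun P _ => ?_
  have factored := A.sum_outcomeProb_eq_mul (bases := BitPartition.virtualBases) (β := 1) P
    (fun l => by rw [BitPartition.virtualBases, Pi.add_apply, P.b_infoPos, P.s_infoPos, zero_add])
    (fun l => by rw [BitPartition.virtualBases, Pi.add_apply, P.b_testZPos, P.s_testZPos, add_zero])
    (fun l => by rw [BitPartition.virtualBases, Pi.add_apply, P.b_testXPos, P.s_testXPos, add_zero])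
    (fun a => if D ≤ 2 * hammingNorm a then 1 else 0)
    (fun u w => if errorRate u ≤ paz ∧ errorRate w ≤ pax then 1 else 0)
  simp only [← ite_and, ite_mul, one_mul, zero_mul] at factored
  simp only [ge_iff_le, le_errorRate_iff hn, tailWeight, Finset.sum_filter,
    CollectiveAttack.passProb]
  convert factored

lemma eventProb_partition_eq_and (bases : BitPartition n nz nx → BitString (n + nz + nx))
    (P : BitPartition n nz nx)
    (E : BitPartition n nz nx → BitString (n + nz + nx) → BitString (n + nz + nx) → Prop)
    [∀ i iB, Decidable (E P i iB)] :
    eventProb A bases (fun Q i iB => Q = P ∧ E Q i iB) =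
      ∑ i, ∑ iB, if E P i iB then outcomeProb A bases P i iB else 0 := by
  rw [eventProb, Fintype.sum_eq_single P]
  · simp only [true_and]
  · intro Q hQ
    simp only [hQ, false_and, if_false, Finset.sum_const_zero]

lemma sum_mul_sum_fiber {Y ι κ R : Type*} [Fintype Y] [DecidableEq Y] [Fintype ι] [Fintype κ]
    [NonUnitalNonAssocSemiring R] (g : Y → R) (X : ι → κ → Y) (p : ι → κ → R) :
    ∑ y, g y * ∑ i, ∑ l, (if X i l = y then p i l else 0) = ∑ i, ∑ l, g (X i l) * p i l := by
  simp only [Finset.mul_sum, mul_ite, mul_zero]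
  rw [Finset.sum_comm]
  refine Finset.sum_congr rfl fun i _ => ?_
  rw [Finset.sum_comm]
  simp only [Finset.sum_ite_eq, Finset.mem_univ, if_true]

lemma sum_mul_eventProb_realBases {r : ℕ} (PC : Matrix (Fin r) (Fin n) (ZMod 2))
    (P : BitPartition n nz nx) (g : BitString nz → BitString nx → ℝ) :
    ∑ ξ : BitString r, ∑ cz : BitString nz, ∑ cb : BitString nx, g cz cb *
      eventProb A BitPartition.realBases (fun Q i iB =>
        Q = P ∧ PC.mulVec (Q.info i) = ξ ∧ Q.testZ (i + iB) = cz ∧ Q.testX (i + iB) = cb) =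
      (Fintype.card (BitPartition n nz nx) : ℝ)⁻¹ * ∑ u, ∑ w, g u w * A.testErrProb P u w := by
  have factored := A.sum_outcomeProb_eq_mul (bases := BitPartition.realBases) P P.b_infoPos
    P.b_testZPos P.b_testXPos (fun _ => 1) g
  have fibers := sum_mul_sum_fiber
    (fun y : BitString r × BitString nz × BitString nx => g y.2.1 y.2.2)
    (fun i iB => (PC.mulVec (P.info i), P.testZ (i + iB), P.testX (i + iB)))
    (outcomeProb A BitPartition.realBases P)
  simp only [one_mul, A.sum_errStringProb] at factored
  simp only [Fintype.sum_prod_type, Prod.mk.injEq, factored] at fibers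
  simp only [← fibers]
  congr! 7 with ξ _ cz _ cb _
  exact eventProb_partition_eq_and A _ P fun Q i iB =>
    PC.mulVec (Q.info i) = ξ ∧ Q.testZ (i + iB) = cz ∧ Q.testX (i + iB) = cb

end Events

/-! ## The average over the partitions -/

section Average

variable {n nz nx r m : ℕ} (A : CollectiveAttack (n + nz + nx))

open scoped Matrix.Norms.Frobenius in
lemma exists_isErrorExpansion_eveState (P : BitPartition n nz nx) :
    ∃ H : BitString n → Matrix (EveIndex A P) (Fin n → ZMod 2 ⊕ ZMod 2) ℂ,
      IsErrorExpansion (eveState A P) H ∧ ∀ d, ‖H d‖ ^ 2 = A.errStringProb P.infoPos 1 d := by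
  choose η hη hnorm using fun l => A.exists_isBitErrorExpansion_probeState (P.infoPos l)
  have hstate : eveState A P = fun x => piMatrix fun l => A.probeState (P.infoPos l) 0 (x l) := by
    have hbasis (l : Fin n) : P.info P.realBases l = 0 := P.b_infoPos l
    ext x f g
    simp only [eveState, hbasis]
    rfl
  refine ⟨fun d => piMatrix fun l => η l (d l), hstate ▸ .piMatrix hη, fun d => ?_⟩
  rw [frobenius_norm_sq_piMatrix]
  exact Finset.prod_congr rfl fun l _ => hnorm l (d l)

lemma traceDist_eveKeyState_le_tailWeight (P : BitPartition n nz nx)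
    {PC : Matrix (Fin r) (Fin n) (ZMod 2)} {PK : Matrix (Fin m) (Fin n) (ZMod 2)}
    (hrows : LinearIndependent (ZMod 2) (codeRows PC PK)) (ξ : BitString r) (k k' : BitString m) :
    traceDist (eveKeyState A P PC PK ξ k) (eveKeyState A P PC PK ξ k') ≤
      2 * m * √(tailWeight (A.errStringProb P.infoPos 1) (minDist PC PK)) := by
  obtain ⟨H, hH, hnorm⟩ := exists_isErrorExpansion_eveState A P
  simpa only [hnorm] using traceDist_eveKeyState_le hH hrows ξ k k'

lemma expectedDeltaEve_le {PC : Matrix (Fin r) (Fin n) (ZMod 2)}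
    {PK : Matrix (Fin m) (Fin n) (ZMod 2)} (hrows : LinearIndependent (ZMod 2) (codeRows PC PK))
    (paz pax : ℝ) (k k' : BitString m) :
    expectedDeltaEve A PC PK paz pax k k' ≤
      2 * m * ∑ P, (Fintype.card (BitPartition n nz nx) : ℝ)⁻¹ * A.passProb P paz pax *
        √(tailWeight (A.errStringProb P.infoPos 1) (minDist PC PK)) := by
  classical
  rw [expectedDeltaEve, Finset.mul_sum]
  refine Finset.sum_le_sum fun P _ => ?_
  set B := 2 * m * √(tailWeight (A.errStringProb P.infoPos 1) (minDist PC PK)) with hB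
  let g : BitString nz → BitString nx → ℝ := fun u w =>
    if errorRate u ≤ paz ∧ errorRate w ≤ pax then B else 0
  have hdelta (ξ : BitString r) (cz : BitString nz) (cb : BitString nx) :
      deltaEve A PC PK paz pax k k' P ξ cz cb ≤ g cz cb := by
    simp only [deltaEve, g]
    split_ifs
    exacts [traceDist_eveKeyState_le_tailWeight A P hrows ξ k k', le_rfl]
  refine (Finset.sum_le_sum fun ξ _ => Finset.sum_le_sum fun cz _ => Finset.sum_le_sum fun cb _ =>
    mul_le_mul_of_nonneg_right (hdelta ξ cz cb) (eventProb_nonneg A _ _)).trans_eq ?_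
  have hpass : ∑ u, ∑ w, g u w * A.testErrProb P u w = B * A.passProb P paz pax := by
    simp only [g, CollectiveAttack.passProb, Finset.mul_sum, mul_ite, ite_mul, mul_zero, zero_mul]
  rw [sum_mul_eventProb_realBases, hpass, hB]
  ring

lemma sum_inv_card_mul_passProb_le_one (paz pax : ℝ) :
    ∑ P, (Fintype.card (BitPartition n nz nx) : ℝ)⁻¹ * A.passProb P paz pax ≤ 1 := by
  calc ∑ P, (Fintype.card (BitPartition n nz nx) : ℝ)⁻¹ * A.passProb P paz pax
      ≤ ∑ _P : BitPartition n nz nx, (Fintype.card (BitPartition n nz nx) : ℝ)⁻¹ :=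
        Finset.sum_le_sum fun P _ =>
          mul_le_of_le_one_right (by positivity) (A.passProb_le_one P paz pax)
    _ ≤ 1 := by
        rw [Finset.sum_const, Finset.card_univ, nsmul_eq_mul]
        exact mul_inv_le_one

end Average

lemma sum_mul_sqrt_le_sqrt_sum_mul {ι : Type*} [Fintype ι] {w q : ι → ℝ} (hw : ∀ i, 0 ≤ w i)
    (hsum : ∑ i, w i ≤ 1) (hq : ∀ i, 0 ≤ q i) : ∑ i, w i * √(q i) ≤ √(∑ i, w i * q i) := by
  calc ∑ i, w i * √(q i) = ∑ i, √(w i) * √(w i * q i) :=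
        Finset.sum_congr rfl fun i _ => by
          rw [Real.sqrt_mul (hw i), ← mul_assoc, Real.mul_self_sqrt (hw i)]
    _ ≤ √(∑ i, w i) * √(∑ i, w i * q i) :=
        Real.sum_sqrt_mul_sqrt_le _ hw fun i => mul_nonneg (hw i) (hq i)
    _ ≤ √(∑ i, w i * q i) :=
        mul_le_of_le_one_left (Real.sqrt_nonneg _) (Real.sqrt_le_one.mpr hsum)

end

end BB84InfoZ

theorem mainTheorem3 (n nz nx r m : ℕ) (hnz : 0 < nz) (hnx : 0 < nx) (hm : 0 < m)
    (PC : Matrix (Fin r) (Fin n) (ZMod 2)) (PK : Matrix (Fin m) (Fin n) (ZMod 2))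
    (hrows : LinearIndependent (ZMod 2) (BB84InfoZ.codeRows PC PK))
    (paz pax : ℝ) (A : BB84InfoZ.CollectiveAttack (n + nz + nx))
    (k k' : BB84InfoZ.BitString m) :
    BB84InfoZ.expectedDeltaEve A PC PK paz pax k k' ≤
      2 * (m : ℝ) * Real.sqrt
        (BB84InfoZ.eventProb A BB84InfoZ.BitPartition.virtualBases (fun P i iB =>
          BB84InfoZ.errorRate (P.info (i + iB)) ≥
              (BB84InfoZ.minDist PC PK : ℝ) / (2 * (n : ℝ)) ∧
            BB84InfoZ.errorRate (P.testZ (i + iB)) ≤ paz ∧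
            BB84InfoZ.errorRate (P.testX (i + iB)) ≤ pax)) := by
  have hn : 0 < n := by
    have : r + m ≤ n := by simpa using hrows.fintype_card_le_finrank
    omega
  refine (BB84InfoZ.expectedDeltaEve_le A hrows paz pax k k').trans ?_
  rw [BB84InfoZ.eventProb_virtualBases A hn]
  refine mul_le_mul_of_nonneg_left ?_ (by positivity)
  simp only [mul_comm (BB84InfoZ.tailWeight _ _), ← mul_assoc]
  exact BB84InfoZ.sum_mul_sqrt_le_sqrt_sum_mul
    (fun P => mul_nonneg (by positivity) (A.passProb_nonneg P paz pax))
    (BB84InfoZ.sum_inv_card_mul_passProb_le_one A paz pax)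
    (fun P => BB84InfoZ.tailWeight_nonneg (A.errStringProb_nonneg P.infoPos 1) _)
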